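/- Let $n\ge 2$. For complex symmetric $n\times n$ matrices $A,B,S$ put $\Sigma=xA+yB$, and let $P=\det\Sigma$ and $T=\operatorname{tr}(S\operatorname{adj}\Sigma)$ in $\mathbb C[x,y]$. Put $$f=PP_x+PT_x-TP_x,\qquad g=PP_y+PT_y-TP_y,$$ where subscripts denote partial derivatives; these are the numerators of the score equations, i.e. of the partial derivatives of $\log\det\Sigma+\operatorname{tr}(S\Sigma^{-1})=\log P+T/P$, after multiplication by $P^2$. Let $F,G\in\mathbb C[x,y,z]$ be the homogenizations of $f,g$ with respect to $z$, let $I_q(F,G)=\dim_{\mathbb C}\mathcal O_{\mathbb P^2,q}/(F,G)$ be the intersection multiplicity at $q\in\mathbb P^2_{\mathbb C}$, and let $V(F,G,z)\subset\mathbb P^2_{\mathbb C}$ be the set of common zeros of $F$, $G$ and $z$. The ML-degree of the linear Gaussian covariance model $\mathcal M_{A,B}$ (the positive definite matrices in the span of $A$ and $B$) is the number of complex solutions of the score equations, counted with multiplicity, for generic symmetric $S$; that is, the degree (the number of points of the variety, counted with multiplicity) of the zero-dimensional ideal $$J=\langle f,g\rangle:\langle\det\Sigma\rangle^\infty=\{h\in\mathbb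 C[x,y] : hP^N\in\langle f,g\rangle\text{ for some }N\}$$ for generic symmetric $S$. Here a property holds for generic symmetric matrices (or pairs of them) if it holds on a non-empty Zariski open subset of the space of complex symmetric matrices (or pairs). Proposition. For generic symmetric $A$ and $B$, the ML-degree of $\mathcal M_{A,B}$ is well defined, and for generic symmetric $S$ the set $V(F,G,z)$ is finite, the intersection multiplicities of $F$ and $G$ at $[0:0:1]$ and at the points of $V(F,G,z)$ are finite, and the ML-degree of $\mathcal M_{A,B}$ equals $$(2n-1)^2-I_{[0:0:1]}(F,G)-\sum_{q\in V(F,G,z)}I_q(F,G).$$ -/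

import Mathlib

noncomputable section

open MvPolynomial

namespace GaussianCovariance

/-! ### Genericity for tuples of symmetric matrices -/

/-- `p M` holds for a generic `k`-tuple `M` of complex symmetric `n × n` matrices: there is a
non-empty Zariski open subset of the linear space of such tuples on which `p` holds. The open
subset is the complement of the set of common zeros of a collection `s` of polynomials in the
matrix entries. -/
def GenericallySymm (n k : ℕ) (p : (Fin k → Matrix (Fin n) (Fin n) ℂ) → Prop) : Prop :=
  ∃ s : Set (MvPolynomial (Fin k × Fin n × Fin n) ℂ),
    (∃ M : Fin k → Matrix (Fin n) (Fin n) ℂ, (∀ i, (M i).IsSymm) ∧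
      ∃ h ∈ s, eval (fun t => M t.1 t.2.1 t.2.2) h ≠ 0) ∧
    ∀ M : Fin k → Matrix (Fin n) (Fin n) ℂ, (∀ i, (M i).IsSymm) →
      (∃ h ∈ s, eval (fun t => M t.1 t.2.1 t.2.2) h ≠ 0) → p M

/-! ### The score equations -/

section Score

variable {n : ℕ}

/-- The matrix `Σ = xA + yB` with entries in `ℂ[x, y]`; here `x = X 0` and `y = X 1`. -/
def covMatrix (A B : Matrix (Fin n) (Fin n) ℂ) :
    Matrix (Fin n) (Fin n) (MvPolynomial (Fin 2) ℂ) :=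
  (X 0 : MvPolynomial (Fin 2) ℂ) • A.map C + (X 1 : MvPolynomial (Fin 2) ℂ) • B.map C

/-- `P = det Σ`. -/
def detPoly (A B : Matrix (Fin n) (Fin n) ℂ) : MvPolynomial (Fin 2) ℂ :=
  (covMatrix A B).det

/-- `T = tr (S adj Σ)`. -/
def tracePoly (A B S : Matrix (Fin n) (Fin n) ℂ) : MvPolynomial (Fin 2) ℂ :=
  (S.map C * (covMatrix A B).adjugate).trace

/-- The numerator of the derivative of `log P + T / P` in the `i`-th variable, after
multiplication by `P ^ 2`. -/
def scoreNumerator (A B S : Matrix (Fin n) (Fin n) ℂ) (i : Fin 2) : MvPolynomial (Fin 2) ℂ :=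
  detPoly A B * pderiv i (detPoly A B) + detPoly A B * pderiv i (tracePoly A B S)
    - tracePoly A B S * pderiv i (detPoly A B)

/-- `f = P P_x + P T_x - T P_x`. -/
def scoreF (A B S : Matrix (Fin n) (Fin n) ℂ) : MvPolynomial (Fin 2) ℂ :=
  scoreNumerator A B S 0

/-- `g = P P_y + P T_y - T P_y`. -/
def scoreG (A B S : Matrix (Fin n) (Fin n) ℂ) : MvPolynomial (Fin 2) ℂ :=
  scoreNumerator A B S 1

end Score

/-! ### Saturation, local multiplicities, degree -/

/-- The saturation `I : ⟨P⟩^∞ = {h | h * P ^ N ∈ I for some N}`. -/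
def saturation {R : Type*} [CommRing R] (I : Ideal R) (P : R) : Ideal R where
  carrier := {h | ∃ N : ℕ, h * P ^ N ∈ I}
  zero_mem' := ⟨0, by simp⟩
  add_mem' := by
    rintro a b ⟨N, hN⟩ ⟨K, hK⟩
    refine ⟨N + K, ?_⟩
    have e : (a + b) * P ^ (N + K) = P ^ K * (a * P ^ N) + P ^ N * (b * P ^ K) := by ring
    rw [e]
    exact I.add_mem (I.mul_mem_left _ hN) (I.mul_mem_left _ hK)
  smul_mem' := by
    rintro c a ⟨N, hN⟩
    refine ⟨N, ?_⟩
    rw [smul_eq_mul, mul_assoc]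
    exact I.mul_mem_left _ hN

/-- The local ring `𝒪_p` of the affine plane at `p`: the localization of `ℂ[x, y]` at the maximal
ideal of the polynomials that vanish at `p`. -/
abbrev LocalRingAt (p : Fin 2 → ℂ) : Type :=
  Localization.AtPrime (vanishingIdeal ℂ {p})

/-- The multiplicity `dim_ℂ (𝒪_p / I 𝒪_p)` of an ideal `I ⊆ ℂ[x, y]` at the point `p`. -/
def localMultiplicity (I : Ideal (MvPolynomial (Fin 2) ℂ)) (p : Fin 2 → ℂ) : ℕ∞ :=
  Cardinal.toENat (Module.rank ℂ
    (LocalRingAt p ⧸ I.map (algebraMap (MvPolynomial (Fin 2) ℂ) (LocalRingAt p))))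

/-- The ideal `I` is zero-dimensional of degree `d`: its variety is finite and has exactly `d`
points, counted with multiplicity. -/
def HasDegree (I : Ideal (MvPolynomial (Fin 2) ℂ)) (d : ℕ) : Prop :=
  (zeroLocus ℂ I).Finite ∧ ∑ᶠ p ∈ zeroLocus ℂ I, localMultiplicity I p = (d : ℕ∞)

/-- The ideal `J = ⟨f, g⟩ : ⟨det Σ⟩^∞` of the critical points of the log-likelihood. -/
def criticalIdeal {n : ℕ} (A B S : Matrix (Fin n) (Fin n) ℂ) :
    Ideal (MvPolynomial (Fin 2) ℂ) :=
  saturation (Ideal.span {scoreF A B S, scoreG A B S}) (detPoly A B)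

/-- `d` is the ML-degree of the model spanned by `A` and `B`: for generic symmetric `S`, the
score equations have exactly `d` complex solutions, counted with multiplicity. -/
def IsMLDegree {n : ℕ} (A B : Matrix (Fin n) (Fin n) ℂ) (d : ℕ) : Prop :=
  GenericallySymm n 1 fun M => HasDegree (criticalIdeal A B (M 0)) d

/-! ### Plane curves -/

/-- The homogenization `z ^ (deg h) * h (x / z, y / z)`; here `z = X 2`. -/
def homogenization (h : MvPolynomial (Fin 2) ℂ) : MvPolynomial (Fin 3) ℂ :=
  ∑ k ∈ Finset.range (h.totalDegree + 1),
    rename Fin.castSucc (homogeneousComponent k h) * X 2 ^ (h.totalDegree - k)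

/-- The complex projective plane. -/
abbrev ProjPlane : Type := Projectivization ℂ (Fin 3 → ℂ)

/-- The point `[0 : 0 : 1]`. -/
def originPoint : ProjPlane :=
  Projectivization.mk ℂ ![0, 0, 1] (fun h => one_ne_zero (congrFun h 2))

/-- The common zeros in the projective plane of a set of homogeneous polynomials. -/
def projVariety (s : Set (MvPolynomial (Fin 3) ℂ)) : Set ProjPlane :=
  {q | ∀ H ∈ s, eval q.rep H = 0}

/-- The index of a non-zero homogeneous coordinate of `v ≠ 0`. -/
def chartIndex (v : Fin 3 → ℂ) : Fin 3 :=
  open Classical in if v 2 ≠ 0 then 2 else if v 0 ≠ 0 then 0 else 1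

/-- The dehomogenization of `H` in the chart `X i = 1`; the two remaining variables keep their
order. -/
def dehomogenization (i : Fin 3) (H : MvPolynomial (Fin 3) ℂ) : MvPolynomial (Fin 2) ℂ :=
  aeval (i.insertNth (α := fun _ => MvPolynomial (Fin 2) ℂ) 1 X) H

/-- The affine coordinates in the chart `X i = 1` of the point with homogeneous coordinates
`v`, where `v i ≠ 0`. -/
def chartPoint (i : Fin 3) (v : Fin 3 → ℂ) : Fin 2 → ℂ :=
  fun j => v (i.succAbove j) / v i

/-- The intersection multiplicity `I_q(H, K) = dim_ℂ 𝒪_q / (H, K)` of two projective plane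
curves, computed in an affine chart that contains `q`. -/
def intersectionMultiplicity (q : ProjPlane) (H K : MvPolynomial (Fin 3) ℂ) : ℕ∞ :=
  localMultiplicity
    (Ideal.span {dehomogenization (chartIndex q.rep) H, dehomogenization (chartIndex q.rep) K})
    (chartPoint (chartIndex q.rep) q.rep)

end GaussianCovariance

end

noncomputable section

open MvPolynomial

namespace GaussianCovariance

/-! ### The order filtration of a polynomial ring -/

section Order

variable {σ K : Type*} [Field K]

/-! Write `n = k + 2`. Then `P` and `T` are binary forms of degrees `k + 2` and `k + 1`, and each
score numerator is a form `P P_x` of degree `2k + 3` plus a form `P T_x - T P_x` of degree `2k + 2`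
(likewise for `y`). Bézout's theorem is not used: the three quantities in the formula are computed
separately for forms in general position (`IsGenericPair`), and the result is the identity `2k + 1 =
(2k + 3)² - (2k + 2)² - 2(k + 2)`.

Critical points (`IsGenericPair.hasDegree`): with `W = P_x T_y - P_y T_x`, Euler's identity gives `x
f + y g = P ((k + 2) P - T)`, and `P_x g - P_y f = P W`. Hence the critical points are given by `W =
0`, `(k + 2) P = T` and `P ≠ 0`. The form `W` vanishes on `2k + 1` lines through the origin. Since
the degrees of `P` and `T` differ by one, each line carries exactly one solution off the origin, and
it is simple.

Origin: the initial forms of `f` and `g` are the parts of degree `2k + 2`. They are coprime, so the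
multiplicity is `(2k + 2)²`.

Infinity: the common zeros are the `k + 2` zeros of `P`. There `F` and `G` share a tangent, but
replacing `F` by `F + (y / x) G` yields coprime initial forms of degrees `2` and `1`, hence
multiplicity `2`.

All these multiplicities come from `localMultiplicity_span_pair`: coprime initial forms of degrees
`d` and `e` give `d * e`. It rests on a dimension count in `K[x, y]` modulo powers of the ideal of
the point.

General position is the non-vanishing of `tripleDiscr`, a polynomial in the entries of `A`, `B`, `S`
built from resultants. A pencil of diagonal matrices shows that it is not identically zero on
symmetric triples. -/

lemma eq_zero_of_isHomogeneous_of_mem_pow {h : MvPolynomial σ K} {j : ℕ}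
    (hh : h.IsHomogeneous j) (hm : h ∈ idealOfVars σ K ^ (j + 1)) : h = 0 := by
  rw [mem_pow_idealOfVars_iff'] at hm
  ext x
  rw [coeff_zero]
  by_cases hx : x.degree = j
  · exact hm x (by omega)
  · exact hh.coeff_eq_zero hx

lemma mem_pow_of_isHomogeneous {h : MvPolynomial σ K} {j : ℕ} (hh : h.IsHomogeneous j) :
    h ∈ idealOfVars σ K ^ j := by
  rw [mem_pow_idealOfVars_iff']
  exact fun x hx => hh.coeff_eq_zero hx.ne

lemma sub_homogeneousComponent_mem {a : MvPolynomial σ K} {k : ℕ}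
    (ha : a ∈ idealOfVars σ K ^ k) :
    a - homogeneousComponent k a ∈ idealOfVars σ K ^ (k + 1) := by
  rw [mem_pow_idealOfVars_iff'] at ha ⊢
  intro x hx
  rw [coeff_sub, coeff_homogeneousComponent]
  split_ifs with h
  · exact sub_self _
  · rw [ha x (by omega), sub_zero]

lemma mem_pow_succ_of_homogeneousComponent_eq_zero {a : MvPolynomial σ K} {k : ℕ}
    (ha : a ∈ idealOfVars σ K ^ k) (h : homogeneousComponent k a = 0) :
    a ∈ idealOfVars σ K ^ (k + 1) := by
  simpa [h] using sub_homogeneousComponent_mem ha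

lemma mem_pow_of_initial {f f₀ : MvPolynomial σ K} {d : ℕ} (hf₀ : f₀.IsHomogeneous d)
    (hf : f - f₀ ∈ idealOfVars σ K ^ (d + 1)) : f ∈ idealOfVars σ K ^ d := by
  have := Ideal.add_mem _ (Ideal.pow_le_pow_right (Nat.le_succ d) hf) (mem_pow_of_isHomogeneous hf₀)
  simpa using this

/-- Multiplication by a polynomial with initial form of degree `d` raises the order by
exactly `d`. -/
lemma mem_pow_of_mul_mem_pow {f f₀ : MvPolynomial σ K} {d : ℕ} (hf₀ : f₀.IsHomogeneous d)
    (h0 : f₀ ≠ 0) (hf : f - f₀ ∈ idealOfVars σ K ^ (d + 1)) {a : MvPolynomial σ K} (k : ℕ)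
    (ha : f * a ∈ idealOfVars σ K ^ (k + d)) : a ∈ idealOfVars σ K ^ k := by
  induction k with
  | zero => simp
  | succ k ih =>
    have hk : a ∈ idealOfVars σ K ^ k :=
      ih (Ideal.pow_le_pow_right (by omega) ha)
    refine mem_pow_succ_of_homogeneousComponent_eq_zero hk ?_
    have h1 := Ideal.mul_mem_mul (mem_pow_of_isHomogeneous hf₀) (sub_homogeneousComponent_mem hk)
    have h2 := Ideal.mul_mem_mul hf hk
    rw [← pow_add] at h1 h2
    -- Modulo order `d + k + 1`, this product agrees with `f * a`, which has that order. A form of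
    -- degree `d + k` with order above its degree is zero.
    have h3 : f₀ * homogeneousComponent k a ∈ idealOfVars σ K ^ (d + k + 1) := by
      have e : f₀ * homogeneousComponent k a =
          f * a - f₀ * (a - homogeneousComponent k a) - (f - f₀) * a := by ring
      rw [e]
      refine Ideal.sub_mem _ (Ideal.sub_mem _ ?_ ?_) ?_
      · convert ha using 2; omega
      · convert h1 using 2; omega
      · convert h2 using 2; omega
    have h4 := eq_zero_of_isHomogeneous_of_mem_pow
      (hf₀.mul (homogeneousComponent_isHomogeneous k a)) h3
    exact (mul_eq_zero.mp h4).resolve_left h0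

/-- If the initial forms of `f` and `g` are coprime, then multiplication by `g` raises the order
modulo `f` by exactly the degree of the initial form of `g`. -/
lemma mem_sup_pow_of_mul_mem_sup_pow {f f₀ g g₀ : MvPolynomial σ K} {d e : ℕ}
    (hf₀ : f₀.IsHomogeneous d) (h0 : f₀ ≠ 0) (hf : f - f₀ ∈ idealOfVars σ K ^ (d + 1))
    (hg₀ : g₀.IsHomogeneous e) (h0' : g₀ ≠ 0) (hg : g - g₀ ∈ idealOfVars σ K ^ (e + 1))
    (hfg : IsRelPrime f₀ g₀) {a : MvPolynomial σ K} (k : ℕ)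
    (ha : g * a ∈ Ideal.span {f} ⊔ idealOfVars σ K ^ (k + e)) :
    a ∈ Ideal.span {f} ⊔ idealOfVars σ K ^ k := by
  induction k with
  | zero => simp
  | succ k ih =>
    have hk := ih (sup_le_sup_left (α := Ideal _) (Ideal.pow_le_pow_right (m := k + e) (by omega)) (Ideal.span {f}) ha)
    rw [Submodule.mem_sup] at hk
    obtain ⟨y, hy, a', ha', rfl⟩ := hk
    refine Ideal.add_mem _ (Ideal.mem_sup_left hy) ?_
    have h1 : g * a' ∈ Ideal.span {f} ⊔ idealOfVars σ K ^ (k + 1 + e) := by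
      have := Ideal.sub_mem _ ha (Ideal.mem_sup_left (Ideal.mul_mem_left _ g hy))
      rwa [mul_add, add_sub_cancel_left] at this
    rw [Submodule.mem_sup] at h1
    obtain ⟨z, hz, m, hm, hzm⟩ := h1
    obtain ⟨b, rfl⟩ := Ideal.mem_span_singleton'.mp hz
    have hga : g * a' ∈ idealOfVars σ K ^ (k + e) := by
      have := Ideal.mul_mem_mul (mem_pow_of_initial hg₀ hg) ha'
      rw [← pow_add] at this
      convert this using 2; omega
    have hfd := mem_pow_of_initial hf₀ hf
    have hfb : f * b ∈ idealOfVars σ K ^ (k + e) := by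
      have e1 : f * b = g * a' - m := by rw [← hzm]; ring
      rw [e1]
      exact Ideal.sub_mem _ hga (Ideal.pow_le_pow_right (by omega) hm)
    -- If `k + e < d`, the multiple `b * f` already has order at least `k + e + 1`, so `f` plays no
    -- role and the previous lemma applies to `g`.
    by_cases hlt : k + e < d
    · refine Ideal.mem_sup_right (mem_pow_of_mul_mem_pow hg₀ h0' hg _ ?_)
      rw [← hzm]
      refine Ideal.add_mem _ (Ideal.pow_le_pow_right (by omega) (Ideal.mul_mem_left _ b hfd)) hm
    · obtain ⟨l, hl⟩ : ∃ l, k + e = l + d := ⟨k + e - d, by omega⟩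
      have hb : b ∈ idealOfVars σ K ^ l := mem_pow_of_mul_mem_pow hf₀ h0 hf l (hl ▸ hfb)
      -- The terms of degree `k + e` in `g a' = b f + m` are compared. Coprimality then makes `f₀`
      -- divide the degree-`k` part of `a'`.
      have key : g₀ * homogeneousComponent k a' - f₀ * homogeneousComponent l b = 0 := by
        refine eq_zero_of_isHomogeneous_of_mem_pow (j := k + e) ?_ ?_
        · refine IsHomogeneous.sub ?_ ?_
          · rw [add_comm]; exact hg₀.mul (homogeneousComponent_isHomogeneous k a')
          · rw [hl, add_comm]; exact hf₀.mul (homogeneousComponent_isHomogeneous l b)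
        · have e1 : g₀ * homogeneousComponent k a' - f₀ * homogeneousComponent l b =
              m - g₀ * (a' - homogeneousComponent k a') - (g - g₀) * a'
                + f₀ * (b - homogeneousComponent l b) + (f - f₀) * b := by
            have : m = g * a' - b * f := by rw [← hzm]; ring
            rw [this]; ring
          rw [e1]
          have m1 := Ideal.mul_mem_mul (mem_pow_of_isHomogeneous hg₀)
            (sub_homogeneousComponent_mem ha')
          have m2 := Ideal.mul_mem_mul hg ha'
          have m3 := Ideal.mul_mem_mul (mem_pow_of_isHomogeneous hf₀)
            (sub_homogeneousComponent_mem hb)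
          have m4 := Ideal.mul_mem_mul hf hb
          rw [← pow_add] at m1 m2 m3 m4
          refine Ideal.add_mem _ (Ideal.add_mem _ (Ideal.sub_mem _ (Ideal.sub_mem _ ?_ ?_) ?_) ?_) ?_
          · exact Ideal.pow_le_pow_right (by omega) hm
          · exact Ideal.pow_le_pow_right (by omega) m1
          · exact Ideal.pow_le_pow_right (by omega) m2
          · exact Ideal.pow_le_pow_right (by omega) m3
          · exact Ideal.pow_le_pow_right (by omega) m4
      have hdvd : f₀ ∣ homogeneousComponent k a' := by
        refine hfg.dvd_of_dvd_mul_left ⟨homogeneousComponent l b, ?_⟩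
        linear_combination key
      obtain ⟨c, hc⟩ := hdvd
      have hck : f₀ * c ∈ idealOfVars σ K ^ k :=
        hc ▸ mem_pow_of_isHomogeneous (homogeneousComponent_isHomogeneous k a')
      by_cases hkd : k < d
      · refine Ideal.mem_sup_right (mem_pow_succ_of_homogeneousComponent_eq_zero ha' ?_)
        refine eq_zero_of_isHomogeneous_of_mem_pow (homogeneousComponent_isHomogeneous k a') ?_
        rw [hc]
        exact Ideal.pow_le_pow_right (by omega)
          (Ideal.mul_mem_right c _ (mem_pow_of_isHomogeneous hf₀))
      · obtain ⟨r, hr⟩ : ∃ r, k = r + d := ⟨k - d, by omega⟩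
        have hcr : c ∈ idealOfVars σ K ^ r :=
          mem_pow_of_mul_mem_pow hf₀ h0 (by simp) r (hr ▸ hck)
        -- Subtracting `c * f` removes the degree-`k` part of `a'` and leaves only terms of order `k
        -- + 1`.
        have e1 : a' = c * f + ((a' - homogeneousComponent k a') - (f - f₀) * c) := by
          rw [hc]; ring
        rw [e1]
        refine Ideal.add_mem _ (Ideal.mem_sup_left
          (Ideal.mul_mem_left _ c (Ideal.mem_span_singleton_self f)))
          (Ideal.mem_sup_right (Ideal.sub_mem _ (sub_homogeneousComponent_mem ha') ?_))
        have := Ideal.mul_mem_mul hf hcr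
        rw [← pow_add] at this
        exact Ideal.pow_le_pow_right (by omega) this

end Order

/-! ### Dimensions of quotients -/

section Dimension

variable {K R : Type*} [Field K] [CommRing R] [Algebra K R]

/-- Multiplication by `f` embeds `R / I` into `R / L` with cokernel `R / (f, L)`. -/
lemma finrank_quotient_eq_add (I L : Ideal R) (f : R) (h : ∀ a, f * a ∈ L ↔ a ∈ I)
    [Module.Finite K (R ⧸ L)] :
    Module.finrank K (R ⧸ L) =
      Module.finrank K (R ⧸ I) + Module.finrank K (R ⧸ (Ideal.span {f} ⊔ L)) := by
  let π : (R ⧸ L) →ₐ[K] R ⧸ (Ideal.span {f} ⊔ L) := Ideal.Quotient.factorₐ K le_sup_right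
  let μ : (R ⧸ I) →ₗ[K] R ⧸ L :=
    ((Submodule.mapQ I L (LinearMap.mulLeft R f) (fun a ha => (h a).mpr ha)).restrictScalars K)
  have hμ : Function.Injective μ := by
    rw [← LinearMap.ker_eq_bot, LinearMap.ker_eq_bot']
    intro x hx
    obtain ⟨a, rfl⟩ := Ideal.Quotient.mk_surjective x
    have : Ideal.Quotient.mk L (f * a) = 0 := hx
    rw [Ideal.Quotient.eq_zero_iff_mem] at this ⊢
    exact (h a).mp this
  have hπ : Function.Surjective π := Ideal.Quotient.factor_surjective le_sup_right
  have hker : LinearMap.ker π.toLinearMap = LinearMap.range μ := by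
    ext x
    obtain ⟨a, rfl⟩ := Ideal.Quotient.mk_surjective x
    rw [LinearMap.mem_ker, LinearMap.mem_range]
    have e1 : π.toLinearMap (Ideal.Quotient.mk L a) = Ideal.Quotient.mk _ a := rfl
    rw [e1, Ideal.Quotient.eq_zero_iff_mem, Submodule.mem_sup]
    constructor
    · rintro ⟨y, hy, z, hz, rfl⟩
      obtain ⟨b, rfl⟩ := Ideal.mem_span_singleton'.mp hy
      refine ⟨Ideal.Quotient.mk I b, ?_⟩
      have e2 : μ (Ideal.Quotient.mk I b) = Ideal.Quotient.mk L (f * b) := rfl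
      rw [e2, Ideal.Quotient.eq]
      have : f * b - (b * f + z) = -z := by ring
      rw [this]
      exact neg_mem hz
    · rintro ⟨y, hy⟩
      obtain ⟨b, rfl⟩ := Ideal.Quotient.mk_surjective y
      have e2 : μ (Ideal.Quotient.mk I b) = Ideal.Quotient.mk L (f * b) := rfl
      rw [e2, Ideal.Quotient.eq] at hy
      exact ⟨b * f, Ideal.mul_mem_left _ _ (Ideal.mem_span_singleton_self f), a - b * f,
        by rw [← neg_mem_iff]; convert hy using 1; ring, by ring⟩
  have h1 := LinearMap.finrank_range_add_finrank_ker π.toLinearMap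
  rw [LinearMap.range_eq_top.mpr hπ, finrank_top, hker, LinearMap.finrank_range_of_inj hμ] at h1
  omega

lemma eq_of_le_of_finrank_quotient_eq {I L : Ideal R} (hIL : I ≤ L)
    [Module.Finite K (R ⧸ I)] [Module.Finite K (R ⧸ L)]
    (h : Module.finrank K (R ⧸ I) = Module.finrank K (R ⧸ L)) : I = L := by
  let π : (R ⧸ I) →ₐ[K] R ⧸ L := Ideal.Quotient.factorₐ K hIL
  have hπ : Function.Surjective π.toLinearMap := Ideal.Quotient.factor_surjective hIL
  have hinj := (LinearMap.injective_iff_surjective_of_finrank_eq_finrank h).mpr hπ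
  refine le_antisymm hIL fun a ha => ?_
  rw [← Ideal.Quotient.eq_zero_iff_mem]
  apply hinj
  rw [map_zero]
  exact Ideal.Quotient.eq_zero_iff_mem.mpr ha

end Dimension

/-! ### Truncations of `K[x, y]` by powers of the ideal of the origin -/

section Plane

variable {K : Type*} [Field K]

/-- The monomials of degree less than `N` in two variables. -/
def lowMonomial (N : ℕ) (q : (k : Fin N) × Fin (k + 1)) : Fin 2 →₀ ℕ :=
  Finsupp.single 0 (q.2 : ℕ) + Finsupp.single 1 ((q.1 : ℕ) - q.2)

lemma exists_lowMonomial_eq {N : ℕ} {x : Fin 2 →₀ ℕ} (hx : x.degree < N) :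
    ∃ q, lowMonomial N q = x := by
  rw [Finsupp.degree_eq_sum, Fin.sum_univ_two] at hx
  refine ⟨⟨⟨x 0 + x 1, hx⟩, ⟨x 0, by simp⟩⟩, ?_⟩
  ext i
  fin_cases i <;> simp [lowMonomial]

lemma degree_lowMonomial {N : ℕ} (q : (k : Fin N) × Fin (k + 1)) :
    (lowMonomial N q).degree = q.1 := by
  have := q.2.2
  rw [Finsupp.degree_eq_sum, Fin.sum_univ_two]
  simp [lowMonomial]
  omega

lemma lowMonomial_injective (N : ℕ) : Function.Injective (lowMonomial N) := by
  intro q r h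
  have h1 : (q.1 : ℕ) = r.1 := by rw [← degree_lowMonomial, ← degree_lowMonomial, h]
  have h2 : (q.2 : ℕ) = r.2 := by simpa [lowMonomial] using DFunLike.congr_fun h 0
  obtain ⟨⟨k, hk⟩, i, hi⟩ := q
  obtain ⟨⟨l, hl⟩, j, hj⟩ := r
  simp only at h1 h2
  subst h1 h2
  rfl

/-- The coefficients of the monomials of degree less than `N`. -/
def lowCoeffs (K : Type*) [Field K] (N : ℕ) :
    MvPolynomial (Fin 2) K →ₗ[K] ((k : Fin N) × Fin (k + 1)) → K :=
  LinearMap.pi fun q => MvPolynomial.lcoeff K (lowMonomial N q)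

lemma ker_lowCoeffs (N : ℕ) : LinearMap.ker (lowCoeffs K N) =
    (idealOfVars (Fin 2) K ^ N).restrictScalars K := by
  ext a
  rw [LinearMap.mem_ker, Submodule.restrictScalars_mem, mem_pow_idealOfVars_iff']
  constructor
  · intro h x hx
    obtain ⟨q, rfl⟩ := exists_lowMonomial_eq hx
    exact congrFun h q
  · intro h
    funext q
    exact h _ (by rw [degree_lowMonomial]; exact q.1.2)

lemma lowCoeffs_surjective (N : ℕ) : Function.Surjective (lowCoeffs K N) := by
  classical
  intro c
  refine ⟨∑ q, monomial (lowMonomial N q) (c q), ?_⟩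
  funext r
  simp [lowCoeffs, coeff_monomial, (lowMonomial_injective N).eq_iff]

/-- The quotient by the `N`-th power of the ideal of the origin, in coordinates. -/
def quotientPowEquiv (K : Type*) [Field K] (N : ℕ) :
    (MvPolynomial (Fin 2) K ⧸ idealOfVars (Fin 2) K ^ N) ≃ₗ[K]
      (((k : Fin N) × Fin (k + 1)) → K) :=
  (Submodule.Quotient.restrictScalarsEquiv K (idealOfVars (Fin 2) K ^ N)).symm.trans
    ((Submodule.quotEquivOfEq _ _ (ker_lowCoeffs N).symm).trans
      ((lowCoeffs K N).quotKerEquivOfSurjective (lowCoeffs_surjective N)))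

instance finite_quotient_pow (N : ℕ) :
    Module.Finite K (MvPolynomial (Fin 2) K ⧸ idealOfVars (Fin 2) K ^ N) :=
  Module.Finite.equiv (quotientPowEquiv K N).symm

instance finite_quotient_sup_pow (I : Ideal (MvPolynomial (Fin 2) K)) (N : ℕ) :
    Module.Finite K (MvPolynomial (Fin 2) K ⧸ (I ⊔ idealOfVars (Fin 2) K ^ N)) :=
  Module.Finite.of_surjective
    (Ideal.Quotient.factorₐ K (le_sup_right : idealOfVars (Fin 2) K ^ N ≤ _)).toLinearMap
    (Ideal.Quotient.factor_surjective le_sup_right)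

lemma two_mul_finrank_quotient_pow (N : ℕ) :
    2 * Module.finrank K (MvPolynomial (Fin 2) K ⧸ idealOfVars (Fin 2) K ^ N) = N * (N + 1) := by
  rw [(quotientPowEquiv K N).finrank_eq, Module.finrank_fintype_fun_eq_card]
  simp only [Fintype.card_sigma, Fintype.card_fin]
  rw [Fin.sum_univ_eq_sum_range (fun k => k + 1)]
  induction N with
  | zero => rfl
  | succ N ih => rw [Finset.sum_range_succ, mul_add, ih]; ring

variable {f f₀ g g₀ : MvPolynomial (Fin 2) K} {d e : ℕ}

/-- Multiplication by `f` raises the order by exactly `d`, so it embeds the truncation at `k` into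
the truncation at `k + d`; the last term is the cokernel. -/
lemma finrank_quotient_span_sup_pow (hf₀ : f₀.IsHomogeneous d) (h0 : f₀ ≠ 0)
    (hf : f - f₀ ∈ idealOfVars (Fin 2) K ^ (d + 1)) (k : ℕ) :
    Module.finrank K (MvPolynomial (Fin 2) K ⧸ idealOfVars (Fin 2) K ^ (k + d)) =
      Module.finrank K (MvPolynomial (Fin 2) K ⧸ idealOfVars (Fin 2) K ^ k) +
      Module.finrank K
        (MvPolynomial (Fin 2) K ⧸ (Ideal.span {f} ⊔ idealOfVars (Fin 2) K ^ (k + d))) := by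
  refine finrank_quotient_eq_add _ _ f fun a => ⟨mem_pow_of_mul_mem_pow hf₀ h0 hf k, fun ha => ?_⟩
  have := Ideal.mul_mem_mul (mem_pow_of_initial hf₀ hf) ha
  rwa [← pow_add, add_comm] at this

/-- The dimension of `K[x, y] / (f, g, 𝔪 ^ N)` for polynomials with coprime initial forms and
large `N` is the product of the degrees of the initial forms. -/
theorem finrank_quotient_span_pair_sup_pow
    (hf₀ : f₀.IsHomogeneous d) (h0 : f₀ ≠ 0) (hf : f - f₀ ∈ idealOfVars (Fin 2) K ^ (d + 1))
    (hg₀ : g₀.IsHomogeneous e) (h0' : g₀ ≠ 0) (hg : g - g₀ ∈ idealOfVars (Fin 2) K ^ (e + 1))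
    (hfg : IsRelPrime f₀ g₀) (j : ℕ) :
    Module.finrank K (MvPolynomial (Fin 2) K ⧸
      (Ideal.span {f, g} ⊔ idealOfVars (Fin 2) K ^ (j + d + e))) = d * e := by
  have hs : Ideal.span {f, g} ⊔ idealOfVars (Fin 2) K ^ (j + d + e) =
      Ideal.span {g} ⊔ (Ideal.span {f} ⊔ idealOfVars (Fin 2) K ^ (j + d + e)) := by
    rw [Ideal.span_insert, sup_comm (Ideal.span {f}), sup_assoc]
  have h1 := finrank_quotient_eq_add (K := K)
    (Ideal.span {f} ⊔ idealOfVars (Fin 2) K ^ (j + d))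
    (Ideal.span {f} ⊔ idealOfVars (Fin 2) K ^ (j + d + e)) g
    (fun a => ⟨mem_sup_pow_of_mul_mem_sup_pow hf₀ h0 hf hg₀ h0' hg hfg (j + d), fun ha => by
      rw [Submodule.mem_sup] at ha ⊢
      obtain ⟨y, hy, z, hz, rfl⟩ := ha
      refine ⟨g * y, Ideal.mul_mem_left _ _ hy, g * z, ?_, by ring⟩
      have := Ideal.mul_mem_mul (mem_pow_of_initial hg₀ hg) hz
      rwa [← pow_add, add_comm] at this⟩)
  have h2 := finrank_quotient_span_sup_pow hf₀ h0 hf j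
  have h3 := finrank_quotient_span_sup_pow hf₀ h0 hf (j + e)
  rw [show j + e + d = j + d + e by ring] at h3
  -- With `D N = N (N + 1) / 2`, the three relations give `D (j + d + e) - D (j + d) - D (j + e) + D
  -- j`. This mixed second difference of a quadratic is the constant `d * e`.
  have D := two_mul_finrank_quotient_pow (K := K)
  have d1 := D (j + d + e)
  have d2 := D (j + d)
  have d3 := D (j + e)
  have d4 := D j
  rw [← hs] at h1
  zify at *
  linarith [show ((j + d + e) * (j + d + e + 1) - (j + d) * (j + d + 1) - (j + e) * (j + e + 1)
    + j * (j + 1) : ℤ) = 2 * (d * e) by ring]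

end Plane

end GaussianCovariance

end

noncomputable section

open MvPolynomial

namespace GaussianCovariance

/-! ### Local multiplicities -/

/-- Modulo `M ^ N` the ideal `M` is nilpotent, so invertibility is decided modulo `M`. Thus
denominators in the localization can be traded for polynomials after truncation. -/
lemma exists_mul_sub_one_mem_pow {R : Type*} [CommRing R] {M : Ideal R} [M.IsMaximal] {s : R}
    (hs : s ∉ M) (N : ℕ) : ∃ s', s' * s - 1 ∈ M ^ N := by
  obtain ⟨b, hb⟩ := (Ideal.Quotient.isUnit_mk_pow_of_notMem M (n := N) hs).exists_left_inv
  obtain ⟨s', rfl⟩ := Ideal.Quotient.mk_surjective b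
  exact ⟨s', by rwa [← Ideal.Quotient.eq, map_mul, map_one]⟩

section Local

variable {v : Fin 2 → ℂ} {I : Ideal (MvPolynomial (Fin 2) ℂ)} {N : ℕ}

/-- Nakayama's lemma: if the powers of the ideal of `v` become stationary modulo `I`, they lie in
`I` locally at `v`. -/
lemma exists_mul_mem_of_pow_le
    (h : vanishingIdeal ℂ {v} ^ N ≤ I ⊔ vanishingIdeal ℂ {v} ^ (N + 1)) :
    ∃ r : MvPolynomial (Fin 2) ℂ, r ∉ vanishingIdeal ℂ {v} ∧
      ∀ a ∈ vanishingIdeal ℂ {v} ^ N, r * a ∈ I := by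
  obtain ⟨r, hr, hrI⟩ := Submodule.exists_sub_one_mem_and_smul_le_of_fg_of_le_sup
    (I := vanishingIdeal ℂ {v}) (N := I) (N' := vanishingIdeal ℂ {v} ^ N)
    (P := vanishingIdeal ℂ {v} ^ N) (IsNoetherian.noetherian _) le_rfl
    (by rwa [smul_eq_mul, ← pow_succ'])
  refine ⟨r, fun hmem => ?_, fun a ha => hrI ?_⟩
  · have := Ideal.sub_mem _ hmem hr
    rw [sub_sub_cancel] at this
    exact (inferInstance : (vanishingIdeal ℂ {v}).IsMaximal).ne_top
      ((Ideal.eq_top_iff_one _).mpr this)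
  · exact Submodule.smul_mem_pointwise_smul a r _ ha

/-- The local multiplicity is the dimension of the quotient by a large power of the ideal of the
point. -/
theorem localMultiplicity_eq_rank
    (h : vanishingIdeal ℂ {v} ^ N ≤ I ⊔ vanishingIdeal ℂ {v} ^ (N + 1)) :
    localMultiplicity I v = Cardinal.toENat
      (Module.rank ℂ (MvPolynomial (Fin 2) ℂ ⧸ (I ⊔ vanishingIdeal ℂ {v} ^ N))) := by
  obtain ⟨r, hr, hrI⟩ := exists_mul_mem_of_pow_le h
  set ι := algebraMap (MvPolynomial (Fin 2) ℂ) (LocalRingAt v) with hι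
  let ψ : MvPolynomial (Fin 2) ℂ →ₐ[ℂ] LocalRingAt v ⧸ I.map ι :=
    (Ideal.Quotient.mkₐ ℂ (I.map ι)).comp
      (IsScalarTower.toAlgHom ℂ (MvPolynomial (Fin 2) ℂ) (LocalRingAt v))
  have hψ : ∀ a, ψ a = 0 ↔ ∃ s ∉ vanishingIdeal ℂ {v}, s * a ∈ I := by
    intro a
    have e1 : ψ a = Ideal.Quotient.mk _ (ι a) := rfl
    rw [e1, Ideal.Quotient.eq_zero_iff_mem,
      IsLocalization.algebraMap_mem_map_algebraMap_iff (vanishingIdeal ℂ {v}).primeCompl]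
    rfl
  have hle : ∀ a ∈ I ⊔ vanishingIdeal ℂ {v} ^ N, ψ a = 0 := by
    intro a ha
    rw [Submodule.mem_sup] at ha
    obtain ⟨y, hy, z, hz, rfl⟩ := ha
    rw [hψ]
    exact ⟨r, hr, by rw [mul_add]; exact add_mem (Ideal.mul_mem_left _ _ hy) (hrI z hz)⟩
  let φ := Ideal.Quotient.liftₐ (I ⊔ vanishingIdeal ℂ {v} ^ N) ψ hle
  have hφ : ∀ a, φ (Ideal.Quotient.mk _ a) = ψ a := fun a => rfl
  have hinj : Function.Injective φ := by
    rw [injective_iff_map_eq_zero]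
    intro x hx
    obtain ⟨a, rfl⟩ := Ideal.Quotient.mk_surjective x
    rw [hφ, hψ] at hx
    obtain ⟨s, hs, hsa⟩ := hx
    obtain ⟨s', hs'⟩ := exists_mul_sub_one_mem_pow hs N
    rw [Ideal.Quotient.eq_zero_iff_mem]
    have e1 : a = s' * (s * a) - (s' * s - 1) * a := by ring
    rw [e1]
    exact Ideal.sub_mem _ (Ideal.mem_sup_left (Ideal.mul_mem_left _ _ hsa))
      (Ideal.mem_sup_right (Ideal.mul_mem_right _ _ hs'))
  have hsurj : Function.Surjective φ := by
    intro y
    obtain ⟨z, rfl⟩ := Ideal.Quotient.mk_surjective y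
    obtain ⟨a, s, rfl⟩ := IsLocalization.exists_mk'_eq (vanishingIdeal ℂ {v}).primeCompl z
    obtain ⟨s', hs'⟩ := exists_mul_sub_one_mem_pow s.2 N
    -- Since `s'` inverts `s` modulo the `N`-th power, and that power dies in the target, `a * s'`
    -- represents the fraction `a / s`.
    refine ⟨Ideal.Quotient.mk _ (a * s'), ?_⟩
    have h0 := hle _ (Ideal.mem_sup_right (Ideal.mul_mem_left _ a hs'))
    have e1 : ψ (a * (s' * s - 1)) = Ideal.Quotient.mk (I.map ι) (ι (a * (s' * s - 1))) := rfl
    have e2 : ψ (a * s') = Ideal.Quotient.mk (I.map ι) (ι (a * s')) := rfl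
    rw [e1, Ideal.Quotient.eq_zero_iff_mem] at h0
    rw [hφ, e2, Ideal.Quotient.eq]
    have hu : IsUnit (ι s) := IsLocalization.map_units _ s
    rw [← Ideal.unit_mul_mem_iff_mem _ hu]
    convert h0 using 1
    rw [mul_sub, IsLocalization.mk'_spec'_mk (M := (vanishingIdeal ℂ {v}).primeCompl)]
    rw [← map_mul, ← map_sub]
    congr 1
    ring
  rw [localMultiplicity,
    (LinearEquiv.ofBijective φ.toLinearMap ⟨hinj, hsurj⟩).rank_eq]

/-- Translation by `v`. -/
def translation (v : Fin 2 → ℂ) : MvPolynomial (Fin 2) ℂ ≃ₐ[ℂ] MvPolynomial (Fin 2) ℂ :=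
  AlgEquiv.ofAlgHom (aeval fun i => X i + C (v i)) (aeval fun i => X i - C (v i))
    (by ext i : 1; simp [algebraMap_eq]) (by ext i : 1; simp [algebraMap_eq])

lemma translation_X (v : Fin 2 → ℂ) (i : Fin 2) : translation v (X i) = X i + C (v i) := by
  simp [translation]

lemma map_translation_vanishingIdeal (v : Fin 2 → ℂ) :
    (vanishingIdeal ℂ {v}).map (translation v) = idealOfVars (Fin 2) ℂ := by
  refine le_antisymm ?_ ?_
  · rw [Ideal.map_le_iff_le_comap]
    intro a ha
    rw [mem_vanishingIdeal_singleton_iff] at ha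
    rw [Ideal.mem_comap, ← pow_one (idealOfVars (Fin 2) ℂ), mem_pow_idealOfVars_iff']
    intro x hx
    rw [Nat.lt_one_iff, Finsupp.degree_eq_zero_iff] at hx
    subst hx
    rw [← constantCoeff_eq]
    have e1 : (constantCoeff : MvPolynomial (Fin 2) ℂ →+* ℂ).comp
        (translation v : MvPolynomial (Fin 2) ℂ →+* MvPolynomial (Fin 2) ℂ) =
        (aeval v : MvPolynomial (Fin 2) ℂ →ₐ[ℂ] ℂ) := by
      ext i
      · simp [translation]
      · simp [translation]
    exact (DFunLike.congr_fun e1 a).trans ha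
  · rw [idealOfVars, Ideal.span_le]
    rintro _ ⟨i, rfl⟩
    have e1 : (X i : MvPolynomial (Fin 2) ℂ) = translation v (X i - C (v i)) := by
      rw [map_sub, translation_X]
      have : translation v (C (v i)) = C (v i) := (translation v).commutes (v i)
      rw [this, add_sub_cancel_right]
    rw [e1]
    exact Ideal.mem_map_of_mem _ (by rw [mem_vanishingIdeal_singleton_iff]; simp)

lemma X_sub_C_mem (v : Fin 2 → ℂ) (i : Fin 2) :
    (X i - C (v i) : MvPolynomial (Fin 2) ℂ) ∈ vanishingIdeal ℂ {v} := by
  rw [mem_vanishingIdeal_singleton_iff]; simp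

/-- `h` expressed in the coordinates centred at `v`. -/
def centered (v : Fin 2 → ℂ) (h : MvPolynomial (Fin 2) ℂ) : MvPolynomial (Fin 2) ℂ :=
  aeval (fun i => X i - C (v i)) h

lemma translation_centered (v : Fin 2 → ℂ) (h : MvPolynomial (Fin 2) ℂ) :
    translation v (centered v h) = h :=
  (translation v).apply_symm_apply h

lemma map_translation_pow (v : Fin 2 → ℂ) (k : ℕ) :
    (vanishingIdeal ℂ {v} ^ k).map (translation v) = idealOfVars (Fin 2) ℂ ^ k := by
  rw [Ideal.map_pow, map_translation_vanishingIdeal]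

lemma map_translation_span_pair (v : Fin 2 → ℂ) (f g : MvPolynomial (Fin 2) ℂ) :
    (Ideal.span {f, g}).map (translation v) =
      Ideal.span {translation v f, translation v g} := by
  rw [Ideal.map_span, Set.image_pair]

variable {f f₀ g g₀ : MvPolynomial (Fin 2) ℂ} {d e : ℕ}


lemma translation_sub_mem (hf : f - centered v f₀ ∈ vanishingIdeal ℂ {v} ^ (d + 1)) :
    translation v f - f₀ ∈ idealOfVars (Fin 2) ℂ ^ (d + 1) := by
  have := Ideal.mem_map_of_mem (translation v) hf
  rwa [map_translation_pow, map_sub, translation_centered] at this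

/-- The truncations of `(f, g)` at `d + e` and at `d + e + 1` both have codimension `d * e`, so the
nested ideals are equal. This is the stationarity that Nakayama's lemma needs. -/
lemma pow_le_of_initialForms (hf₀ : f₀.IsHomogeneous d) (h0 : f₀ ≠ 0)
    (hf : f - centered v f₀ ∈ vanishingIdeal ℂ {v} ^ (d + 1))
    (hg₀ : g₀.IsHomogeneous e) (h0' : g₀ ≠ 0)
    (hg : g - centered v g₀ ∈ vanishingIdeal ℂ {v} ^ (e + 1)) (hfg : IsRelPrime f₀ g₀) :
    vanishingIdeal ℂ {v} ^ (d + e) ≤ Ideal.span {f, g} ⊔ vanishingIdeal ℂ {v} ^ (d + e + 1) := by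
  have key := finrank_quotient_span_pair_sup_pow hf₀ h0 (translation_sub_mem hf) hg₀ h0'
    (translation_sub_mem hg) hfg
  have h1 := key 0
  have h2 := key 1
  rw [zero_add] at h1
  rw [show 1 + d + e = d + e + 1 by ring] at h2
  have h3 := eq_of_le_of_finrank_quotient_eq (K := ℂ)
    (sup_le_sup_left (α := Ideal _) (Ideal.pow_le_pow_right (Nat.le_succ (d + e)))
      (Ideal.span {translation v f, translation v g})) (h2.trans h1.symm)
  intro a ha
  have h4 := Ideal.mem_map_of_mem (translation v) ha
  rw [map_translation_pow] at h4
  have h5 : translation v a ∈ (Ideal.span {f, g} ⊔ vanishingIdeal ℂ {v} ^ (d + e + 1)).map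
      (translation v) := by
    rw [Ideal.map_sup, map_translation_span_pair, map_translation_pow]
    exact h3.symm ▸ Ideal.mem_sup_right h4
  obtain ⟨b, hb, hab⟩ := (Ideal.mem_map_iff_of_surjective _ (translation v).surjective).mp h5
  exact (translation v).injective hab ▸ hb

/-- If `f` and `g` have coprime initial forms of degrees `d` and `e` at `v`, then the local
multiplicity of `(f, g)` at `v` is `d * e`. -/
theorem localMultiplicity_span_pair (hf₀ : f₀.IsHomogeneous d) (h0 : f₀ ≠ 0)
    (hf : f - centered v f₀ ∈ vanishingIdeal ℂ {v} ^ (d + 1))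
    (hg₀ : g₀.IsHomogeneous e) (h0' : g₀ ≠ 0)
    (hg : g - centered v g₀ ∈ vanishingIdeal ℂ {v} ^ (e + 1)) (hfg : IsRelPrime f₀ g₀) :
    localMultiplicity (Ideal.span {f, g}) v = (d * e : ℕ) := by
  rw [localMultiplicity_eq_rank (pow_le_of_initialForms hf₀ h0 hf hg₀ h0' hg hfg)]
  have key := finrank_quotient_span_pair_sup_pow hf₀ h0 (translation_sub_mem hf) hg₀ h0'
    (translation_sub_mem hg) hfg 0
  rw [zero_add] at key
  have e1 : Ideal.span {translation v f, translation v g} ⊔ idealOfVars (Fin 2) ℂ ^ (d + e) =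
      (Ideal.span {f, g} ⊔ vanishingIdeal ℂ {v} ^ (d + e)).map
        (translation v : MvPolynomial (Fin 2) ℂ →+* MvPolynomial (Fin 2) ℂ) := by
    rw [Ideal.map_sup]
    exact congrArg₂ _ (map_translation_span_pair v f g).symm (map_translation_pow v _).symm
  rw [(Ideal.quotientEquivAlg _ _ (translation v) e1).toLinearEquiv.rank_eq,
    ← Module.finrank_eq_rank, key]
  simp

end Local

/-- Two polynomials in two variables without a common zero off the origin have no common
factor. -/
lemma isRelPrime_of_forall_eval {f g : MvPolynomial (Fin 2) ℂ}
    (h : ∀ v, eval v f = 0 → eval v g = 0 → v = 0) : IsRelPrime f g := by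
  intro c hcf hcg
  -- By the Nullstellensatz, a common factor with no zero off the origin divides a power of each
  -- variable; powers of distinct variables are coprime.
  have hX : ∀ i, ∃ k, c ∣ (X i : MvPolynomial (Fin 2) ℂ) ^ k := by
    intro i
    have h1 : (X i : MvPolynomial (Fin 2) ℂ) ∈
        vanishingIdeal ℂ (zeroLocus ℂ (Ideal.span {c})) := by
      intro v hv
      have hc : eval v c = 0 := by
        rw [← aeval_eq_eval]
        exact hv c (Ideal.mem_span_singleton_self c)
      have : v = 0 := by
        refine h v ?_ ?_
        · obtain ⟨b, rfl⟩ := hcf; rw [map_mul, hc, zero_mul]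
        · obtain ⟨b, rfl⟩ := hcg; rw [map_mul, hc, zero_mul]
      simp [this]
    rw [vanishingIdeal_zeroLocus_eq_radical] at h1
    obtain ⟨k, hk⟩ := h1
    exact ⟨k, Ideal.mem_span_singleton.mp hk⟩
  obtain ⟨k, hk⟩ := hX 0
  obtain ⟨l, hl⟩ := hX 1
  have hrel : IsRelPrime ((X 0 : MvPolynomial (Fin 2) ℂ) ^ k) (X 1 ^ l) := by
    refine IsRelPrime.pow ?_
    refine ((X_prime (R := ℂ) (i := (0 : Fin 2))).irreducible.isRelPrime_iff_not_dvd).mpr ?_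
    rw [X_dvd_X]
    simp
  exact hrel hk hl

/-- If `f = 0`, coprimality would make `g` a unit, but a form of positive degree vanishes at the
origin. -/
lemma ne_zero_of_forall_eval {f g : MvPolynomial (Fin 2) ℂ} {e : ℕ} (hg : g.IsHomogeneous e)
    (he : e ≠ 0) (h : ∀ v, eval v f = 0 → eval v g = 0 → v = 0) : f ≠ 0 := by
  rintro rfl
  have hu : IsUnit g := isRelPrime_zero_left.mp (isRelPrime_of_forall_eval h)
  have h0 : eval 0 g = 0 := by
    have e1 : eval (0 : Fin 2 → ℂ) g = constantCoeff g := by simp [eval_zero]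
    rw [e1]
    exact hg.coeff_eq_zero (by simpa using he.symm)
  exact (hu.map (eval (0 : Fin 2 → ℂ))).ne_zero h0

end GaussianCovariance

end

noncomputable section

open MvPolynomial

namespace GaussianCovariance

/-! ### Binary forms -/

section BinaryForms

variable {h : MvPolynomial (Fin 2) ℂ} {m : ℕ}

lemma eval_smul_of_isHomogeneous (hh : h.IsHomogeneous m) (c : ℂ) (v : Fin 2 → ℂ) :
    eval (c • v) h = c ^ m * eval v h := by
  rw [eval_eq', eval_eq', Finset.mul_sum]
  refine Finset.sum_congr rfl fun x hx => ?_
  have hd : x.degree = m := by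
    by_contra hne
    exact mem_support_iff.mp hx (hh.coeff_eq_zero hne)
  rw [Finsupp.degree_eq_sum, Fin.sum_univ_two] at hd
  simp only [Fin.prod_univ_two, Pi.smul_apply, smul_eq_mul, ← hd, pow_add, mul_pow]
  ring

lemma euler_identity (hh : h.IsHomogeneous m) :
    X 0 * pderiv 0 h + X 1 * pderiv 1 h = C (m : ℂ) * h := by
  have := hh.sum_X_mul_pderiv
  rw [Fin.sum_univ_two, nsmul_eq_mul] at this
  rw [this, map_natCast]

lemma eval_euler_identity (hh : h.IsHomogeneous m) (v : Fin 2 → ℂ) :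
    v 0 * eval v (pderiv 0 h) + v 1 * eval v (pderiv 1 h) = m * eval v h := by
  simpa using congrArg (eval v) (euler_identity hh)

lemma eval_zero_of_isHomogeneous (hh : h.IsHomogeneous m) (hm : m ≠ 0) :
    eval (0 : Fin 2 → ℂ) h = 0 := by
  have := eval_smul_of_isHomogeneous hh 0 0
  rwa [zero_smul, zero_pow hm, zero_mul] at this

/-- The restriction of a polynomial in two variables to the line `x = 1`. -/
def restrictLine : MvPolynomial (Fin 2) ℂ →ₐ[ℂ] Polynomial ℂ :=
  aeval ![1, Polynomial.X]

lemma eval_restrictLine (r : ℂ) (h : MvPolynomial (Fin 2) ℂ) :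
    (restrictLine h).eval r = eval ![1, r] h := by
  have e1 : ((Polynomial.aeval r).comp restrictLine : MvPolynomial (Fin 2) ℂ →ₐ[ℂ] ℂ) =
      aeval ![1, r] := by
    ext i; fin_cases i <;> simp [restrictLine]
  have := DFunLike.congr_fun e1 h
  rwa [aeval_eq_eval, AlgHom.comp_apply, Polynomial.coe_aeval_eq_eval] at this

lemma derivative_restrictLine (h : MvPolynomial (Fin 2) ℂ) :
    Polynomial.derivative (restrictLine h) = restrictLine (pderiv 1 h) := by
  induction h using MvPolynomial.induction_on with
  | C a => simp [restrictLine]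
  | add p q hp hq => simp [hp, hq]
  | mul_X p i hp =>
    rw [map_mul, Polynomial.derivative_mul, hp, Derivation.leibniz]
    fin_cases i <;> simp [restrictLine, pderiv_X]
    ring

lemma restrictLine_monomial (x : Fin 2 →₀ ℕ) (c : ℂ) :
    restrictLine (monomial x c) = Polynomial.monomial (x 1) c := by
  rw [restrictLine, aeval_monomial, Finsupp.prod_fintype _ _ (by simp), Fin.prod_univ_two]
  simp [← Polynomial.C_mul_X_pow_eq_monomial]

lemma restrictLine_eq_sum (h : MvPolynomial (Fin 2) ℂ) :
    restrictLine h = ∑ x ∈ h.support, Polynomial.monomial (x 1) (coeff x h) := by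
  conv_lhs => rw [h.as_sum, map_sum]
  simp only [restrictLine_monomial]

lemma natDegree_restrictLine_le (hh : h.IsHomogeneous m) : (restrictLine h).natDegree ≤ m := by
  rw [restrictLine_eq_sum]
  refine Polynomial.natDegree_sum_le_of_forall_le _ _ fun x hx => ?_
  refine (Polynomial.natDegree_monomial_le _).trans ?_
  have hd : x.degree = m := by
    by_contra hne
    exact mem_support_iff.mp hx (hh.coeff_eq_zero hne)
  rw [Finsupp.degree_eq_sum, Fin.sum_univ_two] at hd
  omega

/-- Only the monomial `y ^ m` contributes to either side. This coefficient thus records the point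
`[0 : 1]`, the one that the line `x = 1` misses. -/
lemma coeff_restrictLine (hh : h.IsHomogeneous m) :
    (restrictLine h).coeff m = eval ![0, 1] h := by
  rw [restrictLine_eq_sum, eval_eq', Polynomial.finsetSum_coeff]
  refine Finset.sum_congr rfl fun x hx => ?_
  have hd : x.degree = m := by
    by_contra hne
    exact mem_support_iff.mp hx (hh.coeff_eq_zero hne)
  rw [Finsupp.degree_eq_sum, Fin.sum_univ_two] at hd
  rw [Polynomial.coeff_monomial, Fin.prod_univ_two]
  by_cases h0 : x 0 = 0
  · simp [h0, show x 1 = m by omega]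
  · simp [h0, show x 1 ≠ m by omega]

lemma eq_smul_of_ne_zero {v : Fin 2 → ℂ} (hv : v 0 ≠ 0) : v = v 0 • ![1, v 1 / v 0] := by
  ext i
  fin_cases i
  · simp
  · simp [mul_div_cancel₀ _ hv]

/-- A binary form that does not vanish at `[0 : 1]` and whose restriction to `x = 1` has no multiple
roots is squarefree of full degree. -/
structure IsRegularForm (h : MvPolynomial (Fin 2) ℂ) (m : ℕ) : Prop where
  isHomogeneous : h.IsHomogeneous m
  coeff_ne_zero : (restrictLine h).coeff m ≠ 0
  separable : (restrictLine h).Separable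

namespace IsRegularForm

variable (hh : IsRegularForm h m)

include hh

/-- A zero with first coordinate `0` is a multiple of `(0, 1)`, where the value is the leading
coefficient. So the chart `x = 1` sees every zero of the form. -/
lemma ne_zero_of_eval_eq_zero {v : Fin 2 → ℂ} (hv : v ≠ 0) (h0 : eval v h = 0) : v 0 ≠ 0 := by
  intro hv0
  have e1 : v = v 1 • ![0, 1] := by
    ext i
    fin_cases i
    · simp [hv0]
    · simp
  have hv1 : v 1 ≠ 0 := by
    intro hv1
    rw [hv1, zero_smul] at e1
    exact hv e1
  rw [e1, eval_smul_of_isHomogeneous hh.isHomogeneous, ← coeff_restrictLine hh.isHomogeneous] at h0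
  exact mul_ne_zero (pow_ne_zero _ hv1) hh.coeff_ne_zero h0

lemma eval_line_eq_zero {v : Fin 2 → ℂ} (hv : v 0 ≠ 0) (h0 : eval v h = 0) :
    eval ![1, v 1 / v 0] h = 0 := by
  rw [eq_smul_of_ne_zero hv, eval_smul_of_isHomogeneous hh.isHomogeneous] at h0
  exact (mul_eq_zero.mp h0).resolve_left (pow_ne_zero _ hv)

lemma eval_pderiv_line_ne_zero {r : ℂ} (h0 : eval ![1, r] h = 0) :
    eval ![1, r] (pderiv 1 h) ≠ 0 := by
  rw [← eval_restrictLine] at h0 ⊢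
  rw [← derivative_restrictLine]
  exact hh.separable.eval₂_derivative_ne_zero (RingHom.id ℂ) h0

lemma eval_pderiv_ne_zero {v : Fin 2 → ℂ} (hv : v ≠ 0) (h0 : eval v h = 0) :
    eval v (pderiv 1 h) ≠ 0 := by
  have hv0 := hh.ne_zero_of_eval_eq_zero hv h0
  have := hh.eval_pderiv_line_ne_zero (hh.eval_line_eq_zero hv0 h0)
  rw [eq_smul_of_ne_zero hv0, eval_smul_of_isHomogeneous hh.isHomogeneous.pderiv]
  exact mul_ne_zero (pow_ne_zero _ hv0) this

lemma card_roots : (restrictLine h).roots.toFinset.card = m := by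
  rw [Multiset.toFinset_card_of_nodup (Polynomial.nodup_roots hh.separable),
    IsAlgClosed.card_roots_eq_natDegree]
  exact Polynomial.natDegree_eq_of_le_of_coeff_ne_zero
    (natDegree_restrictLine_le hh.isHomogeneous) hh.coeff_ne_zero

lemma mem_roots {r : ℂ} : r ∈ (restrictLine h).roots.toFinset ↔ eval ![1, r] h = 0 := by
  rw [Multiset.mem_toFinset, Polynomial.mem_roots hh.separable.ne_zero, Polynomial.IsRoot.def,
    eval_restrictLine]

end IsRegularForm

end BinaryForms

/-! ### Taylor expansions -/

/-- The linear part of `h` at `v`. -/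
def linearPart (v : Fin 2 → ℂ) (h : MvPolynomial (Fin 2) ℂ) : MvPolynomial (Fin 2) ℂ :=
  C (eval v (pderiv 0 h)) * X 0 + C (eval v (pderiv 1 h)) * X 1

lemma isHomogeneous_C_mul_X_add_C_mul_X (a b : ℂ) :
    (C a * X 0 + C b * X 1 : MvPolynomial (Fin 2) ℂ).IsHomogeneous 1 :=
  (isHomogeneous_C_mul_X a 0).add (isHomogeneous_C_mul_X b 1)

lemma sub_C_eval_mem (v : Fin 2 → ℂ) (h : MvPolynomial (Fin 2) ℂ) :
    h - C (eval v h) ∈ vanishingIdeal ℂ {v} := by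
  rw [mem_vanishingIdeal_singleton_iff]
  simp [aeval_eq_eval]

lemma centered_linearPart (v : Fin 2 → ℂ) (h : MvPolynomial (Fin 2) ℂ) :
    centered v (linearPart v h) = C (eval v (pderiv 0 h)) * (X 0 - C (v 0)) +
      C (eval v (pderiv 1 h)) * (X 1 - C (v 1)) := by
  simp [centered, linearPart, algebraMap_eq]

lemma taylor_sub_mem (v : Fin 2 → ℂ) (h : MvPolynomial (Fin 2) ℂ) :
    h - C (eval v h) - centered v (linearPart v h) ∈ vanishingIdeal ℂ {v} ^ 2 := by
  simp only [centered_linearPart]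
  induction h using MvPolynomial.induction_on with
  | C a => simp
  | add p q hp hq =>
    convert add_mem hp hq using 1
    simp only [map_add]
    ring
  | mul_X p i hp =>
    set L : MvPolynomial (Fin 2) ℂ := C (eval v (pderiv 0 p)) * (X 0 - C (v 0)) +
      C (eval v (pderiv 1 p)) * (X 1 - C (v 1)) with hL
    have hLm : L ∈ vanishingIdeal ℂ {v} :=
      add_mem (Ideal.mul_mem_left _ _ (X_sub_C_mem v 0)) (Ideal.mul_mem_left _ _ (X_sub_C_mem v 1))
    have h1 := Ideal.mul_mem_mul hLm (X_sub_C_mem v i)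
    rw [← pow_two] at h1
    convert add_mem (Ideal.mul_mem_right (X i : MvPolynomial (Fin 2) ℂ) _ hp) h1 using 1
    rw [hL]
    fin_cases i <;> simp [Derivation.leibniz, pderiv_X] <;> ring

lemma centered_mem_pow {h : MvPolynomial (Fin 2) ℂ} {m : ℕ} (hh : h.IsHomogeneous m)
    (v : Fin 2 → ℂ) : centered v h ∈ vanishingIdeal ℂ {v} ^ m := by
  have h1 := mem_pow_of_isHomogeneous hh
  rw [← map_translation_pow v, ← translation_centered v h] at h1
  obtain ⟨b, hb, hab⟩ := (Ideal.mem_map_iff_of_surjective _ (translation v).surjective).mp h1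
  exact (translation v).injective hab ▸ hb

lemma centered_zero (h : MvPolynomial (Fin 2) ℂ) : centered 0 h = h := by
  simp [centered]

/-! ### Simple points -/

lemma localMultiplicity_anti {I J : Ideal (MvPolynomial (Fin 2) ℂ)} (hIJ : I ≤ J)
    (v : Fin 2 → ℂ) : localMultiplicity J v ≤ localMultiplicity I v := by
  refine Cardinal.toENat.monotone' ?_
  exact LinearMap.rank_le_of_surjective
    (Ideal.Quotient.factorₐ ℂ (Ideal.map_mono hIJ)).toLinearMap
    (Ideal.Quotient.factor_surjective (Ideal.map_mono hIJ))

lemma one_le_localMultiplicity {I : Ideal (MvPolynomial (Fin 2) ℂ)} {v : Fin 2 → ℂ}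
    (hv : v ∈ zeroLocus ℂ I) : 1 ≤ localMultiplicity I v := by
  have hle : I ≤ vanishingIdeal ℂ {v} := fun a ha => by
    rw [mem_vanishingIdeal_singleton_iff]; exact hv a ha
  have hne : I.map (algebraMap (MvPolynomial (Fin 2) ℂ) (LocalRingAt v)) ≠ ⊤ := by
    intro htop
    have h1 : I.map (algebraMap (MvPolynomial (Fin 2) ℂ) (LocalRingAt v)) ≤
        IsLocalRing.maximalIdeal (LocalRingAt v) := by
      rw [← Localization.AtPrime.map_eq_maximalIdeal]
      exact Ideal.map_mono hle
    exact (IsLocalRing.maximalIdeal.isMaximal (LocalRingAt v)).ne_top (top_le_iff.mp (htop ▸ h1))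
  have : Nontrivial (LocalRingAt v ⧸
      I.map (algebraMap (MvPolynomial (Fin 2) ℂ) (LocalRingAt v))) :=
    Ideal.Quotient.nontrivial_iff.mpr hne
  rw [localMultiplicity, ← map_one Cardinal.toENat]
  refine Cardinal.toENat.monotone' ?_
  rw [Cardinal.one_le_iff_ne_zero]
  exact (rank_pos (R := ℂ)).ne'

/-- The Jacobian criterion for a point of multiplicity one. -/
theorem localMultiplicity_eq_one {I : Ideal (MvPolynomial (Fin 2) ℂ)} {v : Fin 2 → ℂ}
    (hv : v ∈ zeroLocus ℂ I) {a b : MvPolynomial (Fin 2) ℂ} (ha : a ∈ I) (hb : b ∈ I)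
    (hdet : eval v (pderiv 0 a) * eval v (pderiv 1 b) -
      eval v (pderiv 1 a) * eval v (pderiv 0 b) ≠ 0) : localMultiplicity I v = 1 := by
  refine le_antisymm ?_ (one_le_localMultiplicity hv)
  have ha0 : eval v a = 0 := by rw [← aeval_eq_eval]; exact hv a ha
  have hb0 : eval v b = 0 := by rw [← aeval_eq_eval]; exact hv b hb
  -- Cramer's rule: the linear parts have no common zero off the origin, so `(a, b)` has
  -- multiplicity `1 * 1`; the larger ideal `I` has at most that.
  have hz : ∀ w, eval w (linearPart v a) = 0 → eval w (linearPart v b) = 0 → w = 0 := by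
    intro w h1 h2
    simp only [linearPart, map_add, map_mul, eval_C, eval_X] at h1 h2
    ext i
    apply mul_left_cancel₀ hdet
    fin_cases i <;> simp only [Fin.zero_eta, Fin.mk_one, Pi.zero_apply, mul_zero]
    · linear_combination (eval v (pderiv 1 b)) * h1 - (eval v (pderiv 1 a)) * h2
    · linear_combination (eval v (pderiv 0 a)) * h2 - (eval v (pderiv 0 b)) * h1
  have hla : (linearPart v a).IsHomogeneous 1 := isHomogeneous_C_mul_X_add_C_mul_X _ _
  have hlb : (linearPart v b).IsHomogeneous 1 := isHomogeneous_C_mul_X_add_C_mul_X _ _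
  have h1 := localMultiplicity_span_pair (f := a) (g := b) (v := v) hla
    (ne_zero_of_forall_eval hlb one_ne_zero hz)
    (by simpa [ha0] using taylor_sub_mem v a) hlb
    (ne_zero_of_forall_eval hla one_ne_zero fun w h2 h3 => hz w h3 h2)
    (by simpa [hb0] using taylor_sub_mem v b) (isRelPrime_of_forall_eval hz)
  rw [mul_one, Nat.cast_one] at h1
  rw [← h1]
  refine localMultiplicity_anti ?_ v
  rw [Ideal.span_le]
  rintro x (rfl | rfl)
  · exact ha
  · exact hb

end GaussianCovariance

end

noncomputable section

open MvPolynomial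

namespace GaussianCovariance

/-! ### The score equations of a pair of binary forms -/

/-- The numerator of the `i`-th partial derivative of `log P + T / P`. -/
def score (P T : MvPolynomial (Fin 2) ℂ) (i : Fin 2) : MvPolynomial (Fin 2) ℂ :=
  P * pderiv i P + P * pderiv i T - T * pderiv i P

/-- The part of lower degree of the score equations. -/
def scoreLow (P T : MvPolynomial (Fin 2) ℂ) (i : Fin 2) : MvPolynomial (Fin 2) ℂ :=
  P * pderiv i T - T * pderiv i P

/-- The Jacobian determinant of two binary forms. -/
def jacobian (P T : MvPolynomial (Fin 2) ℂ) : MvPolynomial (Fin 2) ℂ :=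
  pderiv 0 P * pderiv 1 T - pderiv 1 P * pderiv 0 T

/-- A pair of binary forms of degrees `k + 2` and `k + 1` in general position. -/
structure IsGenericPair (k : ℕ) (P T : MvPolynomial (Fin 2) ℂ) : Prop where
  left : IsRegularForm P (k + 2)
  right : IsRegularForm T (k + 1)
  jacobian : IsRegularForm (jacobian P T) (2 * k + 1)
  isCoprime : IsCoprime (restrictLine P) (restrictLine T)

namespace IsGenericPair

variable {k : ℕ} {P T : MvPolynomial (Fin 2) ℂ} (hg : IsGenericPair k P T)

include hg

lemma euler_left (v : Fin 2 → ℂ) :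
    v 0 * eval v (pderiv 0 P) + v 1 * eval v (pderiv 1 P) = (k + 2) * eval v P := by
  simpa using eval_euler_identity hg.left.isHomogeneous v

lemma euler_right (v : Fin 2 → ℂ) :
    v 0 * eval v (pderiv 0 T) + v 1 * eval v (pderiv 1 T) = (k + 1) * eval v T := by
  simpa using eval_euler_identity hg.right.isHomogeneous v

lemma euler_left' : X 0 * pderiv 0 P + X 1 * pderiv 1 P = (k + 2 : MvPolynomial (Fin 2) ℂ) * P := by
  simpa [map_ofNat C 2] using euler_identity hg.left.isHomogeneous

lemma euler_right' : X 0 * pderiv 0 T + X 1 * pderiv 1 T = (k + 1 : MvPolynomial (Fin 2) ℂ) * T := by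
  simpa using euler_identity hg.right.isHomogeneous

lemma eval_line_right_ne_zero {r : ℂ} (h0 : eval ![1, r] P = 0) : eval ![1, r] T ≠ 0 := by
  intro h1
  obtain ⟨a, b, hab⟩ := hg.isCoprime
  have := congrArg (Polynomial.eval r) hab
  simp [eval_restrictLine, h0, h1] at this

lemma eval_right_ne_zero {v : Fin 2 → ℂ} (hv : v ≠ 0) (h0 : eval v P = 0) : eval v T ≠ 0 := by
  have hv0 := hg.left.ne_zero_of_eval_eq_zero hv h0
  intro h1
  exact hg.eval_line_right_ne_zero (hg.left.eval_line_eq_zero hv0 h0)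
    (hg.right.eval_line_eq_zero hv0 h1)

lemma isHomogeneous_scoreLow (i : Fin 2) : (scoreLow P T i).IsHomogeneous (2 * k + 2) := by
  have h1 := hg.left.isHomogeneous.mul (hg.right.isHomogeneous.pderiv (i := i))
  have h2 := hg.right.isHomogeneous.mul (hg.left.isHomogeneous.pderiv (i := i))
  rw [show k + 2 + (k + 1 - 1) = 2 * k + 2 by omega] at h1
  rw [show k + 1 + (k + 2 - 1) = 2 * k + 2 by omega] at h2
  exact h1.sub h2

lemma isHomogeneous_mul_pderiv (i : Fin 2) : (P * pderiv i P).IsHomogeneous (2 * k + 3) := by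
  have h1 := hg.left.isHomogeneous.mul (hg.left.isHomogeneous.pderiv (i := i))
  rwa [show k + 2 + (k + 2 - 1) = 2 * k + 3 by omega] at h1

omit hg in
lemma score_eq (P T : MvPolynomial (Fin 2) ℂ) (i : Fin 2) :
    score P T i = P * pderiv i P + scoreLow P T i := by
  rw [score, scoreLow, add_sub_assoc]

/-! #### The origin -/

/-- Euler's identities turn `x` times the first form plus `y` times the second into `-P T`. On `P =
0` the second form is `-T P_y`, on `T = 0` it is `P T_y`; neither vanishes off the origin, because
the roots are simple and `P`, `T` have no common one. -/
lemma eq_zero_of_eval_scoreLow {v : Fin 2 → ℂ} (h0 : eval v (scoreLow P T 0) = 0)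
    (h1 : eval v (scoreLow P T 1) = 0) : v = 0 := by
  by_contra hv
  simp only [scoreLow, map_sub, map_mul] at h0 h1
  have e1 : eval v P * eval v T = 0 := by
    linear_combination (-v 0) * h0 - v 1 * h1 + eval v P * hg.euler_right v
      - eval v T * hg.euler_left v
  rcases mul_eq_zero.mp e1 with hP | hT
  · rw [hP, zero_mul, zero_sub, neg_eq_zero] at h1
    exact mul_ne_zero (hg.eval_right_ne_zero hv hP) (hg.left.eval_pderiv_ne_zero hv hP) h1
  · rw [hT, zero_mul, sub_zero] at h1
    rcases mul_eq_zero.mp h1 with hP | hT'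
    · exact hg.eval_right_ne_zero hv hP hT
    · exact hg.right.eval_pderiv_ne_zero hv hT hT'

lemma isRelPrime_scoreLow : IsRelPrime (scoreLow P T 0) (scoreLow P T 1) :=
  isRelPrime_of_forall_eval fun _ => hg.eq_zero_of_eval_scoreLow

lemma scoreLow_ne_zero (i : Fin 2) : scoreLow P T i ≠ 0 := by
  fin_cases i
  · exact ne_zero_of_forall_eval (hg.isHomogeneous_scoreLow 1) (by omega)
      fun _ => hg.eq_zero_of_eval_scoreLow
  · exact ne_zero_of_forall_eval (hg.isHomogeneous_scoreLow 0) (by omega)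
      fun _ h1 h0 => hg.eq_zero_of_eval_scoreLow h0 h1

lemma score_sub_mem (i : Fin 2) :
    score P T i - centered 0 (scoreLow P T i) ∈
      vanishingIdeal ℂ {(0 : Fin 2 → ℂ)} ^ (2 * k + 2 + 1) := by
  have := centered_mem_pow (hg.isHomogeneous_mul_pderiv i) 0
  rw [centered_zero] at this ⊢
  rwa [score_eq, add_sub_cancel_right]

theorem localMultiplicity_origin :
    localMultiplicity (Ideal.span {score P T 0, score P T 1}) 0 =
      ((2 * k + 2) * (2 * k + 2) : ℕ) :=
  localMultiplicity_span_pair (hg.isHomogeneous_scoreLow 0) (hg.scoreLow_ne_zero 0)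
    (hg.score_sub_mem 0) (hg.isHomogeneous_scoreLow 1) (hg.scoreLow_ne_zero 1)
    (hg.score_sub_mem 1) hg.isRelPrime_scoreLow

/-! #### The critical points -/

/-- The ideal of the critical points of `log P + T / P`. -/
local notation "J" => saturation (Ideal.span {score P T 0, score P T 1}) P

lemma mul_sub_mul_score :
    X 0 * score P T 0 + X 1 * score P T 1 = P * ((k + 2 : MvPolynomial (Fin 2) ℂ) * P - T) := by
  simp only [score]
  linear_combination (P - T) * hg.euler_left' + P * hg.euler_right'

omit hg in
lemma score_mem (i : Fin 2) : score P T i ∈ Ideal.span {score P T 0, score P T 1} := by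
  fin_cases i
  · exact Ideal.subset_span (Set.mem_insert _ _)
  · exact Ideal.subset_span (Set.mem_insert_of_mem _ rfl)

omit hg in
lemma score_mem_saturation (i : Fin 2) : score P T i ∈ J :=
  ⟨0, by rw [pow_zero, mul_one]; exact score_mem i⟩

/-- Euler's combination of the score numerators has a factor `P`, which the saturation cancels.
Together with `jacobian_mem` this supplies the two equations of the critical points. -/
lemma likelihood_mem : (k + 2 : MvPolynomial (Fin 2) ℂ) * P - T ∈ J := by
  refine ⟨1, ?_⟩
  rw [pow_one, mul_comm, ← hg.mul_sub_mul_score]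
  exact add_mem (Ideal.mul_mem_left _ _ (score_mem 0)) (Ideal.mul_mem_left _ _ (score_mem 1))

omit hg in
lemma jacobian_mem : GaussianCovariance.jacobian P T ∈ J := by
  refine ⟨1, ?_⟩
  have e1 : GaussianCovariance.jacobian P T * P ^ 1 =
      pderiv 0 P * score P T 1 - pderiv 1 P * score P T 0 := by
    simp only [GaussianCovariance.jacobian, score]; ring
  rw [e1]
  exact sub_mem (Ideal.mul_mem_left _ _ (score_mem 1)) (Ideal.mul_mem_left _ _ (score_mem 0))

/-- Near the origin `(f, g)` contains a power of the maximal ideal: some `r` with `r(0) ≠ 0`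
multiplies that power into it. As `P` vanishes at the origin, `r` times a power of `P` lies in `(f,
g)`, so `r` is in the saturation. -/
lemma zero_notMem_zeroLocus : (0 : Fin 2 → ℂ) ∉ zeroLocus ℂ J := by
  intro h0
  obtain ⟨r, hr, hrI⟩ := exists_mul_mem_of_pow_le (pow_le_of_initialForms
    (hg.isHomogeneous_scoreLow 0) (hg.scoreLow_ne_zero 0)
    (hg.score_sub_mem 0) (hg.isHomogeneous_scoreLow 1) (hg.scoreLow_ne_zero 1)
    (hg.score_sub_mem 1) hg.isRelPrime_scoreLow)
  refine hr ((mem_vanishingIdeal_singleton_iff _ _).mpr (h0 r ⟨_, hrI _ (Ideal.pow_mem_pow ?_ _)⟩))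
  rw [mem_vanishingIdeal_singleton_iff, aeval_eq_eval]
  exact eval_zero_of_isHomogeneous hg.left.isHomogeneous (by omega)

/-- At a zero of `P` off the origin, `g` reduces to `-T P_y`, which is not zero there. -/
lemma eval_left_ne_zero_of_mem {v : Fin 2 → ℂ} (hv : v ∈ zeroLocus ℂ J) : eval v P ≠ 0 := by
  intro hP
  have hv0 : v ≠ 0 := fun h => hg.zero_notMem_zeroLocus (h ▸ hv)
  have h1 : eval v (score P T 1) = 0 := by
    rw [← aeval_eq_eval]; exact hv _ (score_mem_saturation 1)
  simp only [score, map_sub, map_add, map_mul, hP, zero_mul, add_zero, zero_sub, neg_eq_zero] at h1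
  exact mul_ne_zero (hg.eval_right_ne_zero hv0 hP) (hg.left.eval_pderiv_ne_zero hv0 hP) h1

lemma mem_zeroLocus_iff {v : Fin 2 → ℂ} : v ∈ zeroLocus ℂ J ↔
    eval v P ≠ 0 ∧ eval v (GaussianCovariance.jacobian P T) = 0 ∧
      (k + 2) * eval v P = eval v T := by
  constructor
  · intro hv
    refine ⟨hg.eval_left_ne_zero_of_mem hv, ?_, ?_⟩
    · rw [← aeval_eq_eval]; exact hv _ jacobian_mem
    · have := hv _ hg.likelihood_mem
      rw [aeval_eq_eval] at this
      simpa [sub_eq_zero] using this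
  · rintro ⟨hP, hW, hT⟩ a ⟨N, hN⟩
    simp only [GaussianCovariance.jacobian, map_sub, map_mul] at hW
    have hk : ((k : ℂ) + 2) ≠ 0 := by exact_mod_cast (by omega : k + 2 ≠ 0)
    -- `W = 0` makes the gradients of `P` and `T` parallel, and Euler's identities with `T = (k + 2)
    -- P` fix the ratio as `k + 1`. Both score numerators then cancel.
    have key : ∀ i, eval v (pderiv i T) = (k + 1) * eval v (pderiv i P) := by
      have e := hg.euler_left v
      have e' := hg.euler_right v
      have hd : ((k : ℂ) + 2) * eval v P ≠ 0 := mul_ne_zero hk hP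
      intro i
      apply mul_left_cancel₀ hd
      fin_cases i <;> simp only [Fin.zero_eta, Fin.mk_one]
      · linear_combination (-eval v (pderiv 0 T) + (k + 1) * eval v (pderiv 0 P)) * e
          + eval v (pderiv 0 P) * e' - (k + 1) * eval v (pderiv 0 P) * e - v 1 * hW
          + (-(k + 1)) * eval v (pderiv 0 P) * hT
      · linear_combination (-eval v (pderiv 1 T) + (k + 1) * eval v (pderiv 1 P)) * e
          + eval v (pderiv 1 P) * e' - (k + 1) * eval v (pderiv 1 P) * e + v 0 * hW
          + (-(k + 1)) * eval v (pderiv 1 P) * hT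
    have hs : ∀ i, eval v (score P T i) = 0 := by
      intro i
      simp only [score, map_sub, map_add, map_mul, key i, ← hT]
      ring
    have hle : Ideal.span {score P T 0, score P T 1} ≤ RingHom.ker (eval v) := by
      rw [Ideal.span_le]
      rintro x (rfl | rfl)
      · exact hs 0
      · exact hs 1
    have h1 := hle hN
    rw [RingHom.mem_ker, map_mul, map_pow] at h1
    rw [aeval_eq_eval]
    exact (mul_eq_zero.mp h1).resolve_right (pow_ne_zero _ hP)

/-- By Euler's identities, `x` times the Jacobian determinant of `W` and `(k + 2) P - T` equals `-(k
+ 2) W_y P` at the point. Here `W_y ≠ 0` because `W` is squarefree. -/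
lemma localMultiplicity_eq_one_of_mem {v : Fin 2 → ℂ} (hv : v ∈ zeroLocus ℂ J) :
    localMultiplicity J v = 1 := by
  refine localMultiplicity_eq_one hv jacobian_mem hg.likelihood_mem ?_
  have hv' := hv
  rw [hg.mem_zeroLocus_iff] at hv'
  obtain ⟨hP, hW, hT⟩ := hv'
  have hv0 : v ≠ 0 := fun h => hg.zero_notMem_zeroLocus (h ▸ hv)
  have hne := hg.jacobian.ne_zero_of_eval_eq_zero hv0 hW
  have hW1 := hg.jacobian.eval_pderiv_ne_zero hv0 hW
  have hW2 := eval_euler_identity hg.jacobian.isHomogeneous v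
  rw [hW, mul_zero] at hW2
  have e := hg.euler_left v
  have e' := hg.euler_right v
  have hk : ((k : ℂ) + 2) ≠ 0 := by exact_mod_cast (by omega : k + 2 ≠ 0)
  have hL : ∀ i, eval v (pderiv i ((k + 2 : MvPolynomial (Fin 2) ℂ) * P - T)) =
      (k + 2) * eval v (pderiv i P) - eval v (pderiv i T) := by
    intro i
    have : ((k : MvPolynomial (Fin 2) ℂ) + 2) * P = C ((k : ℂ) + 2) * P := by
      simp [map_ofNat C 2]
    rw [this, map_sub, pderiv_C_mul, map_sub, map_mul, eval_C]
  rw [hL, hL]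
  intro hdet
  refine mul_ne_zero (mul_ne_zero hW1 hk) hP ?_
  linear_combination (-v 0) * hdet
    + ((k + 2) * eval v (pderiv 1 P) - eval v (pderiv 1 T)) * hW2
    - (k + 2) * eval v (pderiv 1 (GaussianCovariance.jacobian P T)) * e
    + eval v (pderiv 1 (GaussianCovariance.jacobian P T)) * e'
    - (k + 1) * eval v (pderiv 1 (GaussianCovariance.jacobian P T)) * hT

/-- The critical points correspond to the zeros of the Jacobian determinant. -/
lemma zeroLocus_eq_image : zeroLocus ℂ J =
    (fun r : ℂ => (eval ![1, r] T / ((k + 2) * eval ![1, r] P)) • (![1, r] : Fin 2 → ℂ)) ''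
      (restrictLine (GaussianCovariance.jacobian P T)).roots.toFinset := by
  have hk : ((k : ℂ) + 2) ≠ 0 := by exact_mod_cast (by omega : k + 2 ≠ 0)
  ext v
  rw [hg.mem_zeroLocus_iff, Set.mem_image]
  constructor
  · rintro ⟨hP, hW, hT⟩
    have hv0 : v ≠ 0 := by
      rintro rfl
      exact hP (eval_zero_of_isHomogeneous hg.left.isHomogeneous (by omega))
    have hne := hg.jacobian.ne_zero_of_eval_eq_zero hv0 hW
    have hv := eq_smul_of_ne_zero hne
    refine ⟨v 1 / v 0, ?_, ?_⟩
    · rw [Finset.mem_coe, hg.jacobian.mem_roots]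
      exact hg.jacobian.eval_line_eq_zero hne hW
    -- At `s • (1, r)` the equation `(k + 2) P = T` reads `(k + 2) s ^ (k + 2) P(1, r) = s ^ (k + 1)
    -- T(1, r)`, which has only this nonzero solution `s`.
    · have hs : eval ![1, v 1 / v 0] T / ((k + 2) * eval ![1, v 1 / v 0] P) = v 0 := by
        have eP := eval_smul_of_isHomogeneous hg.left.isHomogeneous (v 0) ![1, v 1 / v 0]
        have eT := eval_smul_of_isHomogeneous hg.right.isHomogeneous (v 0) ![1, v 1 / v 0]
        rw [← hv] at eP eT
        rw [eP] at hP
        rw [eP, eT] at hT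
        rw [div_eq_iff (mul_ne_zero hk (right_ne_zero_of_mul hP))]
        apply mul_left_cancel₀ (pow_ne_zero (k + 1) hne)
        rw [← hT]
        ring
      simp only [hs]
      exact hv.symm
  · rintro ⟨r, hr, rfl⟩
    rw [Finset.mem_coe, hg.jacobian.mem_roots] at hr
    have e := hg.euler_left ![1, r]
    have e' := hg.euler_right ![1, r]
    have hW := hr
    simp only [GaussianCovariance.jacobian, map_sub, map_mul] at hW
    simp only [Matrix.cons_val_zero, Matrix.cons_val_one, one_mul] at e e'
    -- On `x = 1`, Euler's identities give `W = (k + 2) P T_y - (k + 1) T P_y`. A zero shared with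
    -- `P` would kill `T P_y`, and one shared with `T` would kill `P T_y`.
    have hP : eval ![1, r] P ≠ 0 := by
      intro hP
      refine mul_ne_zero (mul_ne_zero (hg.left.eval_pderiv_line_ne_zero hP)
        (hg.eval_line_right_ne_zero hP)) (by exact_mod_cast (by omega : k + 1 ≠ 0) :
          ((k : ℂ) + 1) ≠ 0) ?_
      linear_combination -hW - eval ![1, r] (pderiv 1 P) * e' + eval ![1, r] (pderiv 1 T) * e
        + (k + 2) * eval ![1, r] (pderiv 1 T) * hP
    have hT : eval ![1, r] T ≠ 0 := by
      intro hT
      refine mul_ne_zero (mul_ne_zero (hg.right.eval_pderiv_line_ne_zero hT) hP) hk ?_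
      linear_combination hW + eval ![1, r] (pderiv 1 P) * e' - eval ![1, r] (pderiv 1 T) * e
        + (k + 1) * eval ![1, r] (pderiv 1 P) * hT
    have hs : eval ![1, r] T / ((k + 2) * eval ![1, r] P) ≠ 0 :=
      div_ne_zero hT (mul_ne_zero hk hP)
    rw [eval_smul_of_isHomogeneous hg.left.isHomogeneous,
      eval_smul_of_isHomogeneous hg.right.isHomogeneous,
      eval_smul_of_isHomogeneous hg.jacobian.isHomogeneous, hr]
    refine ⟨mul_ne_zero (pow_ne_zero _ hs) hP, mul_zero _, ?_⟩
    rw [pow_succ _ (k + 1)]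
    field_simp

lemma injOn_criticalPoint : Set.InjOn
    (fun r : ℂ => (eval ![1, r] T / ((k + 2) * eval ![1, r] P)) • (![1, r] : Fin 2 → ℂ))
      (restrictLine (GaussianCovariance.jacobian P T)).roots.toFinset := by
  intro r hr s _ h
  have hmem : (eval ![1, r] T / ((k + 2) * eval ![1, r] P)) • (![1, r] : Fin 2 → ℂ) ∈
      zeroLocus ℂ J := hg.zeroLocus_eq_image ▸ Set.mem_image_of_mem _ hr
  have h0 := congrFun h 0
  have h1 := congrFun h 1
  simp only [Pi.smul_apply, Matrix.cons_val_zero, Matrix.cons_val_one, smul_eq_mul,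
    mul_one] at h0 h1
  rw [← h0] at h1
  refine mul_left_cancel₀ (fun hz => hg.zero_notMem_zeroLocus ?_) h1
  rwa [hz, zero_smul] at hmem

theorem hasDegree : HasDegree J (2 * k + 1) := by
  have hfin : (zeroLocus ℂ J).Finite := by
    rw [hg.zeroLocus_eq_image]
    exact (Finset.finite_toSet _).image _
  refine ⟨hfin, ?_⟩
  rw [finsum_mem_congr rfl fun v hv => hg.localMultiplicity_eq_one_of_mem hv,
    finsum_mem_eq_finite_toFinset_sum _ hfin, Finset.sum_const, nsmul_eq_mul, mul_one,
    ← Set.ncard_eq_toFinset_card _ hfin, hg.zeroLocus_eq_image,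
    hg.injOn_criticalPoint.ncard_image, Set.ncard_coe_finset, hg.jacobian.card_roots]

end IsGenericPair

end GaussianCovariance

end

noncomputable section

open MvPolynomial

namespace GaussianCovariance

/-! ### Homogenization and charts -/

/-- The condition `a ≠ 0` fixes the total degree at `m + 1`; this is what gives the lower part
exactly one factor `z`. -/
lemma homogenization_add {m : ℕ} {a b : MvPolynomial (Fin 2) ℂ} (ha : a.IsHomogeneous (m + 1))
    (hb : b.IsHomogeneous m) (ha0 : a ≠ 0) :
    homogenization (a + b) = rename Fin.castSucc a + rename Fin.castSucc b * X 2 := by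
  have hc : ∀ j, homogeneousComponent j (a + b) =
      (if m + 1 = j then a else 0) + (if m = j then b else 0) := by
    intro j
    rw [map_add, homogeneousComponent_of_mem ha, homogeneousComponent_of_mem hb]
    simp only [eq_comm]
  have hd : (a + b).totalDegree = m + 1 := by
    refine le_antisymm ((totalDegree_add _ _).trans (max_le ha.totalDegree_le
      (hb.totalDegree_le.trans (Nat.le_succ m)))) ?_
    by_contra hlt
    have h1 := homogeneousComponent_eq_zero (n := m + 1) (φ := a + b) (by omega)
    rw [hc] at h1
    simp at h1
    exact ha0 h1
  rw [homogenization, hd, Finset.sum_range_succ, Finset.sum_range_succ,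
    Finset.sum_eq_zero fun j hj => ?_]
  · simp [hc, add_comm]
  · rw [Finset.mem_range] at hj
    rw [hc, if_neg (by omega), if_neg (by omega)]
    simp

/-- The substitution `x = 1`, `y = X 0`. -/
def chartMap : MvPolynomial (Fin 2) ℂ →ₐ[ℂ] MvPolynomial (Fin 2) ℂ :=
  aeval ![1, X 0]

lemma eval_chartMap (v : Fin 2 → ℂ) (h : MvPolynomial (Fin 2) ℂ) :
    eval v (chartMap h) = eval ![1, v 0] h := by
  have e1 : ((aeval v).comp chartMap : MvPolynomial (Fin 2) ℂ →ₐ[ℂ] ℂ) = aeval ![1, v 0] := by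
    ext i; fin_cases i <;> simp [chartMap]
  have := DFunLike.congr_fun e1 h
  rwa [aeval_eq_eval, AlgHom.comp_apply, aeval_eq_eval] at this

lemma pderiv_zero_chartMap (h : MvPolynomial (Fin 2) ℂ) :
    pderiv 0 (chartMap h) = chartMap (pderiv 1 h) := by
  induction h using MvPolynomial.induction_on with
  | C a => simp [chartMap, algebraMap_eq]
  | add p q hp hq => simp [hp, hq]
  | mul_X p i hp =>
    rw [map_mul, Derivation.leibniz, hp, Derivation.leibniz]
    fin_cases i <;> simp [chartMap, pderiv_X]

lemma pderiv_one_chartMap (h : MvPolynomial (Fin 2) ℂ) : pderiv 1 (chartMap h) = 0 := by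
  induction h using MvPolynomial.induction_on with
  | C a => simp [chartMap, algebraMap_eq]
  | add p q hp hq => simp [hp, hq]
  | mul_X p i hp =>
    rw [map_mul, Derivation.leibniz, hp]
    fin_cases i <;> simp [chartMap, pderiv_X]

lemma dehomogenization_two_rename (h : MvPolynomial (Fin 2) ℂ) :
    dehomogenization 2 (rename Fin.castSucc h) = h := by
  rw [dehomogenization, aeval_rename]
  have : (Fin.insertNth (α := fun _ => MvPolynomial (Fin 2) ℂ) (2 : Fin 3) 1 X) ∘ Fin.castSucc
      = X := by
    funext i; fin_cases i <;> rfl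
  rw [this, aeval_X_left, AlgHom.id_apply]

lemma dehomogenization_zero_rename (h : MvPolynomial (Fin 2) ℂ) :
    dehomogenization 0 (rename Fin.castSucc h) = chartMap h := by
  rw [dehomogenization, aeval_rename, chartMap]
  congr 2
  funext i; fin_cases i <;> rfl

lemma dehomogenization_two_add (a b : MvPolynomial (Fin 2) ℂ) :
    dehomogenization 2 (rename Fin.castSucc a + rename Fin.castSucc b * X 2) = a + b := by
  have h2 : dehomogenization 2 (X 2) = 1 := by
    rw [dehomogenization, aeval_X]; rfl
  have := dehomogenization_two_rename
  simp only [dehomogenization, map_add, map_mul] at *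
  rw [this, this, h2, mul_one]

lemma dehomogenization_zero_add (a b : MvPolynomial (Fin 2) ℂ) :
    dehomogenization 0 (rename Fin.castSucc a + rename Fin.castSucc b * X 2) =
      chartMap a + chartMap b * X 1 := by
  have h2 : dehomogenization 0 (X 2) = X 1 := by
    rw [dehomogenization, aeval_X]; rfl
  have := dehomogenization_zero_rename
  simp only [dehomogenization, map_add, map_mul] at *
  rw [this, this, h2]

lemma chartMap_sub_mem {h : MvPolynomial (Fin 2) ℂ} {r : ℂ} (h0 : eval ![1, r] h = 0) :
    chartMap h - C (eval ![1, r] (pderiv 1 h)) * (X 0 - C r) ∈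
      vanishingIdeal ℂ {(![r, 0] : Fin 2 → ℂ)} ^ 2 := by
  have h1 := taylor_sub_mem ![r, 0] (chartMap h)
  rw [centered_linearPart, pderiv_zero_chartMap, pderiv_one_chartMap] at h1
  simpa [eval_chartMap, h0] using h1

lemma chartMap_sub_C_mem (h : MvPolynomial (Fin 2) ℂ) (r : ℂ) :
    chartMap h - C (eval ![1, r] h) ∈ vanishingIdeal ℂ {(![r, 0] : Fin 2 → ℂ)} := by
  have h1 := sub_C_eval_mem ![r, 0] (chartMap h)
  rwa [eval_chartMap] at h1

namespace IsGenericPair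

variable {k : ℕ} {P T : MvPolynomial (Fin 2) ℂ} (hg : IsGenericPair k P T)

include hg

/-! #### The points at infinity -/

/-- The intersection multiplicity at a point at infinity is two. -/
theorem localMultiplicity_infinity {r : ℂ} (hr : eval ![1, r] P = 0) :
    localMultiplicity (Ideal.span
      {chartMap (P * pderiv 0 P) + chartMap (scoreLow P T 0) * X 1,
        chartMap (P * pderiv 1 P) + chartMap (scoreLow P T 1) * X 1}) ![r, 0] = 2 := by
  set p := chartMap P with hp
  set t := chartMap T with ht
  set py := chartMap (pderiv 1 P) with hpy
  set ty := chartMap (pderiv 1 T) with hty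
  set F := chartMap (P * pderiv 0 P) + chartMap (scoreLow P T 0) * X 1 with hF
  set G := chartMap (P * pderiv 1 P) + chartMap (scoreLow P T 1) * X 1 with hG
  set M := vanishingIdeal ℂ {(![r, 0] : Fin 2 → ℂ)} with hM
  set a := eval ![1, r] (pderiv 1 P) with ha
  set b := eval ![1, r] T with hb
  have ha0 : a ≠ 0 := hg.left.eval_pderiv_line_ne_zero hr
  have hb0 : b ≠ 0 := hg.eval_line_right_ne_zero hr
  have hk : ((k : ℂ) + 1) ≠ 0 := by exact_mod_cast (by omega : k + 1 ≠ 0)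
  -- At the point, the linear part of `F` is `-r` times that of `G`, so the initial forms of `F` and
  -- `G` are not coprime. Adding `y G`, with `y` the chart coordinate `X 0`, cancels the linear
  -- part, and Euler's identities factor the result.
  set H := p * ((k + 2 : MvPolynomial (Fin 2) ℂ) * p - t * X 1) with hH
  have hFG : F + X 0 * G = H := by
    have e1 := congrArg chartMap hg.euler_left'
    have e2 := congrArg chartMap hg.euler_right'
    have c0 : chartMap (X 0) = 1 := by simp [chartMap]
    have c1 : chartMap (X 1) = X 0 := by simp [chartMap]
    simp only [map_add, map_mul, c0, c1, one_mul, map_natCast, map_ofNat, map_one] at e1 e2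
    simp only [hF, hG, hH, hp, ht, scoreLow, map_sub, map_mul]
    linear_combination (chartMap P - chartMap T * X 1) * e1 + chartMap P * X 1 * e2
  have hspan : Ideal.span {F, G} = Ideal.span {H, G} := by
    rw [← hFG, Set.pair_comm, Set.pair_comm _ G, Ideal.span_pair_add_mul_left]
  rw [hspan]
  have hG' : G = p * py + (p * ty - t * py) * X 1 := by
    simp only [hG, hp, hpy, ht, hty, scoreLow, map_sub, map_mul]
  have m1 : p - C a * (X 0 - C r) ∈ M ^ 2 := chartMap_sub_mem hr
  have m2 : t - C b ∈ M := chartMap_sub_C_mem T r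
  have m3 : py - C a ∈ M := chartMap_sub_C_mem (pderiv 1 P) r
  have u0 : (X 0 - C r : MvPolynomial (Fin 2) ℂ) ∈ M := X_sub_C_mem ![r, 0] 0
  have u1 : (X 1 : MvPolynomial (Fin 2) ℂ) ∈ M := by
    rw [hM, mem_vanishingIdeal_singleton_iff]; simp
  have hpM : p ∈ M := by
    have := add_mem (Ideal.pow_le_self two_ne_zero m1) (M.mul_mem_left (C a) u0)
    rwa [sub_add_cancel] at this
  have hsq : ∀ {x y}, x ∈ M → y ∈ M → x * y ∈ M ^ 2 := fun hx hy => by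
    rw [pow_two]; exact Ideal.mul_mem_mul hx hy
  have hG1 : G - centered ![r, 0] (C (a * a) * X 0 + C (-(b * a)) * X 1) ∈ M ^ (1 + 1) := by
    have e1 : G - centered ![r, 0] (C (a * a) * X 0 + C (-(b * a)) * X 1) =
        (p - C a * (X 0 - C r)) * C a + p * (py - C a) + ty * (p * X 1)
          - t * ((py - C a) * X 1) - C a * ((t - C b) * X 1) := by
      rw [hG']
      simp [centered, algebraMap_eq]
      ring
    rw [e1]
    exact sub_mem (sub_mem (add_mem (add_mem (Ideal.mul_mem_right _ _ m1) (hsq hpM m3))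
      (Ideal.mul_mem_left _ _ (hsq hpM u1))) (Ideal.mul_mem_left _ _ (hsq m3 u1)))
      (Ideal.mul_mem_left _ _ (hsq m2 u1))
  have hH1 : H - centered ![r, 0] ((C a * X 0 + C 0 * X 1) *
      (C ((k + 2) * a) * X 0 + C (-b) * X 1)) ∈ M ^ (2 + 1) := by
    have e1 : H - centered ![r, 0] ((C a * X 0 + C 0 * X 1) *
        (C ((k + 2) * a) * X 0 + C (-b) * X 1)) =
        (p - C a * (X 0 - C r)) * ((k + 2 : MvPolynomial (Fin 2) ℂ) * p - t * X 1)
        + C a * ((k + 2 : MvPolynomial (Fin 2) ℂ) * ((p - C a * (X 0 - C r)) * (X 0 - C r))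
          - ((t - C b) * X 1) * (X 0 - C r)) := by
      have h2 : (k + 2 : MvPolynomial (Fin 2) ℂ) = C ((k : ℂ) + 2) := by simp [map_ofNat C 2]
      rw [hH]
      simp only [h2]
      generalize (k : ℂ) + 2 = c
      simp [centered, algebraMap_eq]
      ring
    rw [e1, pow_succ M 2]
    refine add_mem (Ideal.mul_mem_mul m1 (sub_mem (Ideal.mul_mem_left _ _ hpM)
      (Ideal.mul_mem_left _ _ u1))) (Ideal.mul_mem_left _ _ (sub_mem
      (Ideal.mul_mem_left _ _ (Ideal.mul_mem_mul m1 u0)) (Ideal.mul_mem_mul (hsq m2 u1) u0)))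
  -- With local coordinates `u = y - r` and `z`, the tangents of `H` are `u = 0` and `(k + 2) a u =
  -- b z`, that of `G` is `a u = b z`. The latter differs from both because `a`, `b` and `k + 1` are
  -- nonzero.
  have hz : ∀ w : Fin 2 → ℂ, eval w ((C a * X 0 + C 0 * X 1) * (C ((k + 2) * a) * X 0 + C (-b) * X 1)) = 0 →
      eval w (C (a * a) * X 0 + C (-(b * a)) * X 1) = 0 → w = 0 := by
    intro w h1 h2
    simp only [map_add, map_mul, eval_C, eval_X, zero_mul, add_zero] at h1 h2
    have h3 : a * w 0 = b * w 1 := by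
      apply mul_left_cancel₀ ha0
      linear_combination h2
    have h4 : w 0 = 0 := by
      by_contra hw
      refine mul_ne_zero (mul_ne_zero (mul_ne_zero ha0 hw) (mul_ne_zero ha0 hw)) hk ?_
      linear_combination h1 - a * w 0 * h3
    have h5 : w 1 = 0 := by
      rw [h4, mul_zero] at h3
      exact (mul_eq_zero.mp h3.symm).resolve_left hb0
    ext i
    fin_cases i
    · exact h4
    · exact h5
  have hom2 := (isHomogeneous_C_mul_X_add_C_mul_X a 0).mul
    (isHomogeneous_C_mul_X_add_C_mul_X ((k + 2) * a) (-b))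
  have hom1 := isHomogeneous_C_mul_X_add_C_mul_X (a * a) (-(b * a))
  rw [localMultiplicity_span_pair hom2 (ne_zero_of_forall_eval hom1 one_ne_zero hz) hH1 hom1
    (ne_zero_of_forall_eval hom2 (by omega) fun w h1 h2 => hz w h2 h1) hG1
    (isRelPrime_of_forall_eval hz)]
  rfl

/-- Needed so that the top forms `P P_x` and `P P_y` do not vanish. If `P_x = 0`, then Euler's
identities for `P` and for `P_y` make both vanish at `(1, 0)`, a multiple root; if `P_y = 0`, every
root of `P` is multiple. -/
lemma pderiv_ne_zero (i : Fin 2) : pderiv i P ≠ 0 := by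
  intro hi
  fin_cases i
  · simp only [Fin.zero_eta] at hi
    have e1 := hg.euler_left ![1, 0]
    have hk : ((k : ℂ) + 2) ≠ 0 := by exact_mod_cast (by omega : k + 2 ≠ 0)
    have hk' : ((k : ℂ) + 1) ≠ 0 := by exact_mod_cast (by omega : k + 1 ≠ 0)
    have hP : eval ![1, 0] P = 0 := by simpa [hi, hk] using e1
    have e2 := eval_euler_identity (hg.left.isHomogeneous.pderiv (i := 1)) ![1, 0]
    have hc : pderiv 0 (pderiv 1 P) = 0 := by
      have h1 : ⁅pderiv (R := ℂ) (0 : Fin 2), pderiv (1 : Fin 2)⁆ = 0 :=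
        derivation_ext fun j => by
          rw [Derivation.commutator_apply]; fin_cases j <;> simp [pderiv_X]
      have h2 := DFunLike.congr_fun h1 P
      rwa [Derivation.commutator_apply, hi, map_zero, sub_zero] at h2
    refine hg.left.eval_pderiv_line_ne_zero hP ?_
    simpa [hc, hk'] using e2
  · simp only [Fin.mk_one] at hi
    obtain ⟨r, hr⟩ : ∃ r, r ∈ (restrictLine P).roots.toFinset := by
      refine Finset.card_pos.mp ?_
      rw [hg.left.card_roots]; omega
    refine hg.left.eval_pderiv_line_ne_zero (hg.left.mem_roots.mp hr) ?_
    rw [hi, map_zero]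

lemma homogenization_score (i : Fin 2) : homogenization (score P T i) =
    rename Fin.castSucc (P * pderiv i P) + rename Fin.castSucc (scoreLow P T i) * X 2 := by
  rw [score_eq]
  exact homogenization_add (hg.isHomogeneous_mul_pderiv i) (hg.isHomogeneous_scoreLow i)
    (mul_ne_zero (by
      rintro rfl
      exact hg.pderiv_ne_zero 0 (map_zero _)) (hg.pderiv_ne_zero i))

theorem intersectionMultiplicity_origin :
    intersectionMultiplicity originPoint (homogenization (score P T 0))
      (homogenization (score P T 1)) = ((2 * k + 2) * (2 * k + 2) : ℕ) := by
  obtain ⟨c, hc⟩ := Projectivization.exists_smul_eq_mk_rep ℂ (![0, 0, 1] : Fin 3 → ℂ)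
    (fun h => one_ne_zero (congrFun h 2))
  have hrep : originPoint.rep = (c : ℂ) • ![0, 0, 1] := hc.symm
  have hci : chartIndex originPoint.rep = 2 := by
    rw [hrep, chartIndex, if_pos]
    simp
  have hcp : chartPoint 2 originPoint.rep = 0 := by
    rw [hrep]
    funext j
    fin_cases j <;> simp [chartPoint, Fin.succAbove]
  rw [intersectionMultiplicity, hci, hcp, hg.homogenization_score, hg.homogenization_score,
    dehomogenization_two_add, dehomogenization_two_add, ← score_eq, ← score_eq,
    hg.localMultiplicity_origin]

/-- On `z = 0` the curves become `P P_x = 0` and `P P_y = 0`, and by Euler's identity `P` vanishes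
wherever both its derivatives do. -/
lemma mem_projVariety_iff {q : ProjPlane} :
    q ∈ projVariety {homogenization (score P T 0), homogenization (score P T 1), X 2} ↔
      q.rep 2 = 0 ∧ eval ![q.rep 0, q.rep 1] P = 0 := by
  have hw : q.rep ∘ Fin.castSucc = ![q.rep 0, q.rep 1] := by
    funext i; fin_cases i <;> rfl
  simp only [projVariety, Set.mem_insert_iff, Set.mem_singleton_iff, forall_eq_or_imp, forall_eq,
    Set.mem_ofPred_eq, hg.homogenization_score, map_add, map_mul, eval_X, eval_rename, hw]
  constructor
  · rintro ⟨h0, h1, h2⟩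
    rw [h2, mul_zero, add_zero] at h0 h1
    refine ⟨h2, ?_⟩
    by_contra hP
    have e := hg.euler_left ![q.rep 0, q.rep 1]
    rw [(mul_eq_zero.mp h0).resolve_left hP, (mul_eq_zero.mp h1).resolve_left hP, mul_zero,
      mul_zero, add_zero] at e
    exact mul_ne_zero (by exact_mod_cast (by omega : k + 2 ≠ 0)) hP e.symm
  · rintro ⟨h2, hP⟩
    simp [h2, hP]

lemma rep_zero_ne_zero {q : ProjPlane} (h2 : q.rep 2 = 0)
    (hP : eval ![q.rep 0, q.rep 1] P = 0) : q.rep 0 ≠ 0 := by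
  refine hg.left.ne_zero_of_eval_eq_zero (v := ![q.rep 0, q.rep 1]) (fun h => ?_) hP
  refine q.rep_nonzero ?_
  funext i
  fin_cases i
  · exact congrFun h 0
  · exact congrFun h 1
  · exact h2

theorem intersectionMultiplicity_infinity {q : ProjPlane}
    (hq : q ∈ projVariety {homogenization (score P T 0), homogenization (score P T 1), X 2}) :
    intersectionMultiplicity q (homogenization (score P T 0))
      (homogenization (score P T 1)) = 2 := by
  obtain ⟨h2, hP⟩ := hg.mem_projVariety_iff.mp hq
  have h0 := hg.rep_zero_ne_zero h2 hP
  have hci : chartIndex q.rep = 0 := by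
    rw [chartIndex, if_neg (by simpa using h2), if_pos h0]
  have hcp : chartPoint 0 q.rep = ![q.rep 1 / q.rep 0, 0] := by
    funext j
    fin_cases j
    · rfl
    · simp [chartPoint, h2]
  rw [intersectionMultiplicity, hci, hcp, hg.homogenization_score, hg.homogenization_score,
    dehomogenization_zero_add, dehomogenization_zero_add]
  exact hg.localMultiplicity_infinity (hg.left.eval_line_eq_zero (v := ![q.rep 0, q.rep 1]) h0 hP)

omit hg in
/-- The point `[1 : r : 0]` at infinity. -/
def infinityPoint (r : ℂ) : ProjPlane :=
  Projectivization.mk ℂ ![1, r, 0] (fun h => one_ne_zero (congrFun h 0))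

omit hg in
lemma infinityPoint_injective : Function.Injective infinityPoint := by
  intro r s h
  rw [infinityPoint, infinityPoint, Projectivization.mk_eq_mk_iff'] at h
  obtain ⟨a, ha⟩ := h
  have h0 := congrFun ha 0
  have h1 := congrFun ha 1
  simp only [Pi.smul_apply, Matrix.cons_val_zero, Matrix.cons_val_one, smul_eq_mul,
    mul_one] at h0 h1
  rw [← h1, h0, one_mul]

lemma projVariety_eq_image :
    projVariety {homogenization (score P T 0), homogenization (score P T 1), X 2} =
      infinityPoint '' (restrictLine P).roots.toFinset := by
  ext q
  rw [hg.mem_projVariety_iff, Set.mem_image]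
  constructor
  · rintro ⟨h2, hP⟩
    have h0 := hg.rep_zero_ne_zero h2 hP
    refine ⟨q.rep 1 / q.rep 0, ?_, ?_⟩
    · rw [Finset.mem_coe, hg.left.mem_roots]
      exact hg.left.eval_line_eq_zero (v := ![q.rep 0, q.rep 1]) h0 hP
    · conv_rhs => rw [← q.mk_rep]
      rw [infinityPoint, Projectivization.mk_eq_mk_iff']
      refine ⟨(q.rep 0)⁻¹, ?_⟩
      funext i
      fin_cases i
      · simp [h0]
      · simp [div_eq_inv_mul]
      · simp [h2]
  · rintro ⟨r, hr, rfl⟩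
    rw [Finset.mem_coe, hg.left.mem_roots] at hr
    obtain ⟨c, hc⟩ := Projectivization.exists_smul_eq_mk_rep ℂ (![1, r, 0] : Fin 3 → ℂ)
      (fun h => one_ne_zero (congrFun h 0))
    have hrep : (infinityPoint r).rep = (c : ℂ) • ![1, r, 0] := hc.symm
    rw [hrep]
    refine ⟨by simp, ?_⟩
    have e1 : (![((c : ℂ) • (![1, r, 0] : Fin 3 → ℂ)) 0, ((c : ℂ) • (![1, r, 0] : Fin 3 → ℂ)) 1] :
        Fin 2 → ℂ) = (c : ℂ) • ![1, r] := by
      funext i; fin_cases i <;> simp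
    rw [e1, eval_smul_of_isHomogeneous hg.left.isHomogeneous, hr, mul_zero]

lemma finite_projVariety :
    (projVariety {homogenization (score P T 0), homogenization (score P T 1), X 2}).Finite := by
  rw [hg.projVariety_eq_image]
  exact (Finset.finite_toSet _).image _

theorem finsum_intersectionMultiplicity :
    ∑ᶠ q ∈ projVariety {homogenization (score P T 0), homogenization (score P T 1), X 2},
      ((intersectionMultiplicity q (homogenization (score P T 0))
        (homogenization (score P T 1))).toNat : ℤ) = 2 * (k + 2) := by
  have hfin := hg.finite_projVariety
  rw [finsum_mem_congr (g := fun _ => (2 : ℤ)) rfl fun q hq => by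
      rw [hg.intersectionMultiplicity_infinity hq]; rfl,
    finsum_mem_eq_finite_toFinset_sum _ hfin, Finset.sum_const, nsmul_eq_mul,
    ← Set.ncard_eq_toFinset_card _ hfin, hg.projVariety_eq_image,
    infinityPoint_injective.injOn.ncard_image, Set.ncard_coe_finset, hg.left.card_roots]
  push_cast
  ring

/-- The degree of the critical ideal is the degree of the intersection of the score curves, minus
the contributions of the origin and of the line at infinity. -/
theorem intersection_formula (F G : MvPolynomial (Fin 3) ℂ)
    (hF : F = homogenization (score P T 0)) (hG : G = homogenization (score P T 1)) :
    (projVariety {F, G, X 2}).Finite ∧ intersectionMultiplicity originPoint F G ≠ ⊤ ∧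
      (∀ q ∈ projVariety {F, G, X 2}, intersectionMultiplicity q F G ≠ ⊤) ∧
      ((2 * k + 1 : ℕ) : ℤ) = (2 * ((k + 2 : ℕ) : ℤ) - 1) ^ 2
        - ((intersectionMultiplicity originPoint F G).toNat : ℤ)
        - ∑ᶠ q ∈ projVariety {F, G, X 2}, ((intersectionMultiplicity q F G).toNat : ℤ) := by
  subst hF hG
  refine ⟨hg.finite_projVariety, ?_, fun q hq => ?_, ?_⟩
  · rw [hg.intersectionMultiplicity_origin]
    exact ENat.natCast_ne_top _
  · rw [hg.intersectionMultiplicity_infinity hq]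
    exact ENat.natCast_ne_top 2
  · rw [hg.intersectionMultiplicity_origin, hg.finsum_intersectionMultiplicity, ENat.toNat_natCast]
    push_cast
    ring

end IsGenericPair

end GaussianCovariance

end

noncomputable section

namespace GaussianCovariance

/-! ### Pencils of univariate polynomials -/

section Pencils

open Polynomial Filter

lemma isCoprime_iff_forall_eval {p q : ℂ[X]} :
    IsCoprime p q ↔ ∀ a, p.eval a = 0 → q.eval a ≠ 0 := by
  rw [isCoprime_iff_aeval_ne_zero_of_isAlgClosed ℂ ℂ]
  simp only [coe_aeval_eq_eval]
  exact forall_congr' fun a => by tauto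

/-- Each of the finitely many roots `r` of `p` excludes the single value `e = -a(r) / b(r)`. -/
lemma eventually_isCoprime_add {p a b : ℂ[X]} (hp : p ≠ 0)
    (hb : ∀ r, p.eval r = 0 → b.eval r ≠ 0) :
    ∀ᶠ e : ℂ in cofinite, IsCoprime p (a + C e * b) := by
  have hfin : ((fun r => -a.eval r / b.eval r) '' {r | p.IsRoot r}).Finite :=
    (finite_setOfPred_isRoot hp).image _
  filter_upwards [hfin.compl_mem_cofinite] with e he
  rw [isCoprime_iff_forall_eval]
  intro r hr h0
  refine he ⟨r, hr, ?_⟩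
  simp only [eval_add, eval_mul, eval_C] at h0
  rw [div_eq_iff (hb r hr)]
  linear_combination -h0

/-- A multiple root of `a + e b` is a root of the Wronskian, and it determines `e` because `b`
cannot vanish there. So the roots of the Wronskian exclude finitely many `e`. -/
lemma eventually_separable_add {a b : ℂ[X]} (hab : IsCoprime a b)
    (hw : a * derivative b - derivative a * b ≠ 0) :
    ∀ᶠ e : ℂ in cofinite, (a + C e * b).Separable := by
  have hfin : ((fun r => -a.eval r / b.eval r) ''
      {r | (a * derivative b - derivative a * b).IsRoot r}).Finite :=
    (finite_setOfPred_isRoot hw).image _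
  filter_upwards [hfin.compl_mem_cofinite] with e he
  rw [Polynomial.Separable, isCoprime_iff_forall_eval]
  intro r h0 h1
  simp only [derivative_add, derivative_mul, derivative_C, zero_mul, zero_add, eval_add, eval_mul,
    eval_C] at h0 h1
  have hb : b.eval r ≠ 0 := by
    intro hb
    refine isCoprime_iff_forall_eval.mp hab r ?_ hb
    simpa [hb] using h0
  refine he ⟨r, ?_, ?_⟩
  · show eval r _ = 0
    simp only [eval_sub, eval_mul]
    linear_combination (eval r (derivative b)) * h0 - eval r b * h1
  · rw [div_eq_iff hb]
    linear_combination -h0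

lemma eventually_coeff_add_ne_zero {a b : ℂ[X]} {m : ℕ} (ha : a.coeff m ≠ 0) :
    ∀ᶠ e : ℂ in cofinite, (a + C e * b).coeff m ≠ 0 := by
  by_cases hb : b.coeff m = 0
  · simp [hb, ha]
  · filter_upwards [(Set.finite_singleton (-a.coeff m / b.coeff m)).compl_mem_cofinite] with e he h0
    refine he ?_
    rw [Set.mem_singleton_iff, eq_div_iff hb]
    simp only [coeff_add, coeff_C_mul] at h0
    linear_combination h0

end Pencils

/-! ### The discriminant of a pencil of matrices -/

section Discriminant

open Polynomial

/-- The Jacobian determinant of two binary forms of degrees `k + 2` and `k + 1`, in terms of their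
restrictions to the line `x = 1`. -/
def lineJacobian {R : Type*} [CommRing R] (k : ℕ) (p t : R[X]) : R[X] :=
  (k + 2 : R[X]) * p * derivative t - (k + 1 : R[X]) * derivative p * t

/-- The leading coefficient of a polynomial of degree `m` times its resultant with its
derivative. -/
def regularDiscr {R : Type*} [CommRing R] (f : R[X]) (m : ℕ) : R :=
  f.coeff m * resultant f (derivative f) m (m - 1)

/-- A polynomial in the coefficients of two binary forms that does not vanish if and only if the
forms are in general position. -/
def pairDiscr {R : Type*} [CommRing R] (k : ℕ) (p t : R[X]) : R :=
  regularDiscr p (k + 2) * regularDiscr t (k + 1) *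
    regularDiscr (lineJacobian k p t) (2 * k + 1) * resultant p t (k + 2) (k + 1)

/-- The matrix `A + y B`. -/
def lineMatrix {R : Type*} [CommRing R] {n : ℕ} (A B : Matrix (Fin n) (Fin n) R) :
    Matrix (Fin n) (Fin n) R[X] :=
  A.map C + (X : R[X]) • B.map C

/-- The discriminant of the triple of matrices `A`, `B`, `S`. -/
def tripleDiscr {R : Type*} [CommRing R] (k : ℕ) (A B S : Matrix (Fin (k + 2)) (Fin (k + 2)) R) :
    R :=
  pairDiscr k (lineMatrix A B).det (S.map C * (lineMatrix A B).adjugate).trace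

section Map

variable {R R' : Type*} [CommRing R] [CommRing R'] (φ : R →+* R')

lemma map_regularDiscr (f : R[X]) (m : ℕ) :
    regularDiscr (f.map φ) m = φ (regularDiscr f m) := by
  rw [regularDiscr, regularDiscr, derivative_map, resultant_map_map, coeff_map, map_mul]

lemma map_lineJacobian (k : ℕ) (p t : R[X]) :
    lineJacobian k (p.map φ) (t.map φ) = (lineJacobian k p t).map φ := by
  simp [lineJacobian, derivative_map]

lemma map_pairDiscr (k : ℕ) (p t : R[X]) :
    pairDiscr k (p.map φ) (t.map φ) = φ (pairDiscr k p t) := by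
  simp only [pairDiscr, map_lineJacobian, map_regularDiscr, resultant_map_map, map_mul]

lemma map_lineMatrix {n : ℕ} (A B : Matrix (Fin n) (Fin n) R) :
    lineMatrix (A.map φ) (B.map φ) = (mapRingHom φ).mapMatrix (lineMatrix A B) := by
  ext i j : 2
  simp [lineMatrix]

lemma map_tripleDiscr (k : ℕ) (A B S : Matrix (Fin (k + 2)) (Fin (k + 2)) R) :
    tripleDiscr k (A.map φ) (B.map φ) (S.map φ) = φ (tripleDiscr k A B S) := by
  have hS : (S.map φ).map C = (mapRingHom φ).mapMatrix (S.map C) := by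
    ext i j : 2
    simp
  rw [tripleDiscr, tripleDiscr, ← map_pairDiscr, map_lineMatrix, ← RingHom.map_det,
    ← RingHom.map_adjugate, hS, ← map_mul]
  congr 1
  exact (AddMonoidHom.map_trace (mapRingHom φ).toAddMonoidHom _).symm

end Map

lemma isCoprime_iff_resultant_ne_zero {f g : ℂ[X]} {m l : ℕ} (hf : f.natDegree = m)
    (hg : g.natDegree = l) (hf0 : f ≠ 0) : resultant f g m l ≠ 0 ↔ IsCoprime f g := by
  subst hf hg
  rw [Ne, resultant_eq_zero_iff]
  tauto

/-- The leading-coefficient factor forces the true degree to be the formal degree `m`; only then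
does the resultant detect exactly the common roots with the derivative. -/
lemma regularDiscr_ne_zero_iff {f : ℂ[X]} {m : ℕ} (hf : f.natDegree ≤ m) :
    regularDiscr f m ≠ 0 ↔ f.coeff m ≠ 0 ∧ f.Separable := by
  rw [regularDiscr, mul_ne_zero_iff]
  refine and_congr_right fun h => ?_
  have hd : f.natDegree = m := natDegree_eq_of_le_of_coeff_ne_zero hf h
  exact isCoprime_iff_resultant_ne_zero hd (by rw [natDegree_derivative, hd])
    (by rintro rfl; simp at h)

lemma pairDiscr_ne_zero_iff {k : ℕ} {p t : ℂ[X]} (hp : p.natDegree ≤ k + 2)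
    (ht : t.natDegree ≤ k + 1) (hw : (lineJacobian k p t).natDegree ≤ 2 * k + 1) :
    pairDiscr k p t ≠ 0 ↔ ((p.coeff (k + 2) ≠ 0 ∧ p.Separable) ∧
      (t.coeff (k + 1) ≠ 0 ∧ t.Separable) ∧
      ((lineJacobian k p t).coeff (2 * k + 1) ≠ 0 ∧ (lineJacobian k p t).Separable) ∧
      IsCoprime p t) := by
  rw [pairDiscr, mul_ne_zero_iff, mul_ne_zero_iff, mul_ne_zero_iff, regularDiscr_ne_zero_iff hp,
    regularDiscr_ne_zero_iff ht, regularDiscr_ne_zero_iff hw, and_assoc, and_assoc]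
  refine and_congr_right fun h1 => and_congr_right fun h2 => and_congr_right fun h3 => ?_
  exact isCoprime_iff_resultant_ne_zero (natDegree_eq_of_le_of_coeff_ne_zero hp h1.1)
    (natDegree_eq_of_le_of_coeff_ne_zero ht h2.1) h1.2.ne_zero

end Discriminant

/-! ### Determinant and trace as binary forms, and their restrictions to the line `x = 1` -/

section Forms

open MvPolynomial

variable {k : ℕ}

lemma isHomogeneous_det {m : ℕ} {N : Matrix (Fin m) (Fin m) (MvPolynomial (Fin 2) ℂ)}
    (hN : ∀ i j, (N i j).IsHomogeneous 1) : N.det.IsHomogeneous m := by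
  rw [Matrix.det_apply]
  refine IsHomogeneous.sum _ _ _ fun σ _ => ?_
  have h1 : (∏ i, N (σ i) i).IsHomogeneous (∑ _i : Fin m, 1) :=
    IsHomogeneous.prod _ _ _ fun i _ => hN _ _
  rw [Finset.sum_const, Finset.card_univ, Fintype.card_fin, smul_eq_mul, mul_one] at h1
  rcases Int.units_eq_one_or (Equiv.Perm.sign σ) with h | h
  · simpa [h] using h1
  · simpa [h] using h1.neg

lemma isHomogeneous_covMatrix {n : ℕ} (A B : Matrix (Fin n) (Fin n) ℂ) (i j : Fin n) :
    (covMatrix A B i j).IsHomogeneous 1 := by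
  have := isHomogeneous_C_mul_X_add_C_mul_X (A i j) (B i j)
  simpa [covMatrix, mul_comm] using this

lemma isHomogeneous_detPoly {n : ℕ} (A B : Matrix (Fin n) (Fin n) ℂ) :
    (detPoly A B).IsHomogeneous n :=
  isHomogeneous_det (isHomogeneous_covMatrix A B)

lemma isHomogeneous_tracePoly {m : ℕ} (A B S : Matrix (Fin (m + 1)) (Fin (m + 1)) ℂ) :
    (tracePoly A B S).IsHomogeneous m := by
  refine IsHomogeneous.sum _ _ _ fun i _ => ?_
  rw [Matrix.diag_apply, Matrix.mul_apply]
  refine IsHomogeneous.sum _ _ _ fun j _ => ?_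
  rw [Matrix.map_apply, Matrix.adjugate_fin_succ_eq_det_submatrix]
  refine IsHomogeneous.C_mul ?_ _
  have h1 := isHomogeneous_det (N := (covMatrix A B).submatrix i.succAbove j.succAbove)
    fun a b => isHomogeneous_covMatrix A B _ _
  rcases neg_one_pow_eq_or (MvPolynomial (Fin 2) ℂ) (i + j : ℕ) with h | h
  · rw [h, one_mul]; exact h1
  · rw [h, neg_one_mul]; exact h1.neg

lemma restrictLine_covMatrix {n : ℕ} (A B : Matrix (Fin n) (Fin n) ℂ) :
    (restrictLine : MvPolynomial (Fin 2) ℂ →+* Polynomial ℂ).mapMatrix (covMatrix A B) =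
      lineMatrix A B := by
  ext i j : 2
  simp [covMatrix, lineMatrix, restrictLine]

lemma restrictLine_detPoly {n : ℕ} (A B : Matrix (Fin n) (Fin n) ℂ) :
    restrictLine (detPoly A B) = (lineMatrix A B).det := by
  rw [← restrictLine_covMatrix, ← RingHom.map_det]
  rfl

lemma restrictLine_tracePoly {n : ℕ} (A B S : Matrix (Fin n) (Fin n) ℂ) :
    restrictLine (tracePoly A B S) =
      (S.map Polynomial.C * (lineMatrix A B).adjugate).trace := by
  have hS : S.map Polynomial.C =
      (restrictLine : MvPolynomial (Fin 2) ℂ →+* Polynomial ℂ).mapMatrix (S.map C) := by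
    ext i j : 2
    simp [restrictLine]
  rw [← restrictLine_covMatrix, ← RingHom.map_adjugate, hS, ← map_mul]
  exact AddMonoidHom.map_trace
    (restrictLine : MvPolynomial (Fin 2) ℂ →+* Polynomial ℂ).toAddMonoidHom _

/-- On `x = 1` Euler's identities express the `x`-derivatives through the values and the
`y`-derivatives; the terms in `P_y T_y` cancel. -/
lemma restrictLine_jacobian {P T : MvPolynomial (Fin 2) ℂ} (hP : P.IsHomogeneous (k + 2))
    (hT : T.IsHomogeneous (k + 1)) :
    restrictLine (jacobian P T) = lineJacobian k (restrictLine P) (restrictLine T) := by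
  have e1 := congrArg restrictLine (euler_identity hP)
  have e2 := congrArg restrictLine (euler_identity hT)
  have c0 : restrictLine (X 0) = 1 := by simp [restrictLine]
  have c1 : restrictLine (X 1) = Polynomial.X := by simp [restrictLine]
  simp only [map_add, map_mul, c0, c1, one_mul, map_natCast, Nat.cast_add, map_ofNat,
    map_one, Nat.cast_one, Nat.cast_ofNat] at e1 e2
  simp only [jacobian, lineJacobian, map_sub, map_mul, derivative_restrictLine]
  linear_combination restrictLine (pderiv 1 T) * e1 - restrictLine (pderiv 1 P) * e2

lemma isHomogeneous_jacobian {P T : MvPolynomial (Fin 2) ℂ} (hP : P.IsHomogeneous (k + 2))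
    (hT : T.IsHomogeneous (k + 1)) : (jacobian P T).IsHomogeneous (2 * k + 1) := by
  have h := fun i j => (hP.pderiv (i := i)).mul (hT.pderiv (i := j))
  rw [show k + 2 - 1 + (k + 1 - 1) = 2 * k + 1 by omega] at h
  exact (h 0 1).sub (h 1 0)

theorem isGenericPair_of_tripleDiscr_ne_zero {A B S : Matrix (Fin (k + 2)) (Fin (k + 2)) ℂ}
    (h : tripleDiscr k A B S ≠ 0) : IsGenericPair k (detPoly A B) (tracePoly A B S) := by
  have hP := isHomogeneous_detPoly A B
  have hT := isHomogeneous_tracePoly A B S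
  have hW := isHomogeneous_jacobian hP hT
  rw [tripleDiscr, ← restrictLine_detPoly, ← restrictLine_tracePoly,
    pairDiscr_ne_zero_iff (natDegree_restrictLine_le hP) (natDegree_restrictLine_le hT)
      (restrictLine_jacobian hP hT ▸ natDegree_restrictLine_le hW),
    ← restrictLine_jacobian hP hT] at h
  exact ⟨⟨hP, h.1.1, h.1.2⟩, ⟨hT, h.2.1.1, h.2.1.2⟩, ⟨hW, h.2.2.1.1, h.2.2.1.2⟩, h.2.2.2⟩

end Forms

/-! ### A pencil in general position -/

section Witness

open Polynomial Filter

/-- The choice is `t = (y - 1) ^ (k + 1) + e`. With `c = (k + 1)(k + 2)`, the Jacobian becomes `c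
((y - 1) ^ k (y ^ (k + 1) - 1) - e y ^ (k + 1))`, again a pencil in `e` with coprime members, since
the second vanishes only at `0`. Each condition excludes finitely many `e`. -/
lemma exists_pairDiscr_ne_zero (k : ℕ) :
    ∃ t : ℂ[X], t.natDegree ≤ k + 1 ∧
      (X ^ (k + 2) - 1 : ℂ[X]).coeff (k + 2) ≠ 0 ∧ (X ^ (k + 2) - 1 : ℂ[X]).Separable ∧
      (t.coeff (k + 1) ≠ 0 ∧ t.Separable) ∧
      ((lineJacobian k (X ^ (k + 2) - 1) t).coeff (2 * k + 1) ≠ 0 ∧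
        (lineJacobian k (X ^ (k + 2) - 1) t).Separable) ∧
      IsCoprime (X ^ (k + 2) - 1) t := by
  have hk1 : ((k : ℂ) + 1) ≠ 0 := by exact_mod_cast (by omega : k + 1 ≠ 0)
  have hk2 : ((k : ℂ) + 2) ≠ 0 := by exact_mod_cast (by omega : k + 2 ≠ 0)
  set c : ℂ := (k + 1) * (k + 2) with hc
  have hc0 : c ≠ 0 := mul_ne_zero hk1 hk2
  set a : ℂ[X] := C c * ((X - 1) ^ k * (X ^ (k + 1) - 1)) with ha
  set b : ℂ[X] := C (-c) * X ^ (k + 1) with hb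
  have hJ : ∀ e : ℂ, lineJacobian k (X ^ (k + 2) - 1) ((X - 1) ^ (k + 1) + C e * 1) =
      a + C e * b := by
    intro e
    have hcC : C c = ((k : ℂ[X]) + 1) * (k + 2) := by
      simp [hc, map_ofNat C 2]
    rw [hb, ha, map_neg, hcC]
    simp [lineJacobian, derivative_pow, map_ofNat C 2]
    ring
  have hsep : (X ^ (k + 2) - 1 : ℂ[X]).Separable := by
    rw [X_pow_sub_one_separable_iff]
    exact_mod_cast (by omega : k + 2 ≠ 0)
  have hab : IsCoprime a b := by
    rw [isCoprime_iff_forall_eval]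
    intro r hr h0
    have hr0 : r = 0 := by simpa [hb, hc0] using h0
    rw [hr0] at hr
    simp [ha, hc0] at hr
  have hbd : derivative b ≠ 0 := by
    simp [hb, derivative_pow, hc0]
    exact_mod_cast (by omega : k + 1 ≠ 0)
  have hw : a * derivative b - derivative a * b ≠ 0 := by
    intro h0
    have h1 : b ∣ derivative b := by
      refine hab.symm.dvd_of_dvd_mul_left ⟨derivative a, ?_⟩
      linear_combination h0
    have h2 := natDegree_le_of_dvd h1 hbd
    have h3 : b.natDegree ≠ 0 := by
      rw [hb, natDegree_C_mul_X_pow _ _ (neg_ne_zero.mpr hc0)]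
      omega
    exact absurd h2 (not_le.mpr (natDegree_derivative_lt h3))
  have hX1 : (X - 1 : ℂ[X]).Monic := by simpa using monic_X_sub_C (1 : ℂ)
  have hdX1 : (X - 1 : ℂ[X]).natDegree = 1 := by simpa using natDegree_X_sub_C (1 : ℂ)
  have hXk : ∀ m, (X ^ (m + 1) - 1 : ℂ[X]).Monic := fun m => by
    simpa using monic_X_pow_sub_C (1 : ℂ) (Nat.succ_ne_zero m)
  have hdXk : ∀ m, (X ^ (m + 1) - 1 : ℂ[X]).natDegree = m + 1 := fun m => by
    simpa using natDegree_X_pow_sub_C (R := ℂ) (n := m + 1) (r := 1)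
  have hacoeff : a.coeff (2 * k + 1) ≠ 0 := by
    have h1 := ((hX1.pow k).mul (hXk k)).coeff_natDegree
    rw [(hX1.pow k).natDegree_mul (hXk k), hX1.natDegree_pow, hdX1, hdXk] at h1
    rw [ha, coeff_C_mul, show 2 * k + 1 = k * 1 + (k + 1) by ring, h1, mul_one]
    exact hc0
  have hdt : ((X - 1 : ℂ[X]) ^ (k + 1)).natDegree = k + 1 := by
    rw [hX1.natDegree_pow, hdX1, mul_one]
  have htcoeff : ((X - 1 : ℂ[X]) ^ (k + 1)).coeff (k + 1) ≠ 0 := by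
    have h1 := (hX1.pow (k + 1)).coeff_natDegree
    rw [hdt] at h1
    rw [h1]; exact one_ne_zero
  have htw : (X - 1 : ℂ[X]) ^ (k + 1) * derivative 1 - derivative ((X - 1 : ℂ[X]) ^ (k + 1)) * 1
      ≠ 0 := by
    rw [derivative_one, mul_zero, zero_sub, mul_one, neg_ne_zero]
    intro h0
    have h1 := natDegree_derivative ((X - 1 : ℂ[X]) ^ (k + 1))
    rw [derivative_eq_zero.mp h0] at hdt
    omega
  have hp1 := hXk (k + 1)
  have hev := (eventually_isCoprime_add (a := (X - 1 : ℂ[X]) ^ (k + 1)) (b := 1) hp1.ne_zero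
    (by simp)).and ((eventually_separable_add isCoprime_one_right htw).and
    ((eventually_coeff_add_ne_zero (b := 1) htcoeff).and
    ((eventually_separable_add hab hw).and (eventually_coeff_add_ne_zero (b := b) hacoeff))))
  obtain ⟨e, h1, h2, h3, h4, h5⟩ := hev.exists
  refine ⟨(X - 1) ^ (k + 1) + C e * 1, ?_, ?_, hsep, ⟨h3, h2⟩, ?_, h1⟩
  · refine (natDegree_add_le _ _).trans (max_le hdt.le ?_)
    rw [mul_one, natDegree_C]
    exact Nat.zero_le _
  · have := hp1.coeff_natDegree
    rw [hdXk] at this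
    rw [this]; exact one_ne_zero
  · rw [hJ]
    exact ⟨h5, h4⟩

lemma exists_nodes (m : ℕ) : ∃ ζ : Fin (m + 1) → ℂ, Function.Injective ζ ∧
    (X ^ (m + 1) - 1 : ℂ[X]) = ∏ i, (X - C (ζ i)) := by
  have hprim := Complex.isPrimitiveRoot_exp (m + 1) (Nat.succ_ne_zero m)
  have hcard := hprim.card_nthRootsFinset
  let e := Finset.equivFinOfCardEq hcard
  refine ⟨fun i => (e.symm i : ℂ), Subtype.val_injective.comp e.symm.injective, ?_⟩
  rw [X_pow_sub_one_eq_prod (Nat.succ_pos m) hprim, ← Finset.prod_coe_sort]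
  exact (Equiv.prod_comp e.symm (fun z : nthRootsFinset (m + 1) (1 : ℂ) => (X - C (z : ℂ)))).symm

/-- Lagrange interpolation. -/
lemma exists_sum_nodal_eq {m : ℕ} {ζ : Fin (m + 1) → ℂ} (hζ : Function.Injective ζ) {t : ℂ[X]}
    (ht : t.natDegree ≤ m) :
    ∃ s : Fin (m + 1) → ℂ, ∑ i, C (s i) * ∏ j ∈ Finset.univ.erase i, (X - C (ζ j)) = t := by
  have hne : ∀ i, ∏ j ∈ Finset.univ.erase i, (ζ i - ζ j) ≠ 0 := fun i =>
    Finset.prod_ne_zero_iff.mpr fun j hj => sub_ne_zero.mpr fun h =>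
      Finset.ne_of_mem_erase hj (hζ h).symm
  refine ⟨fun i => t.eval (ζ i) / ∏ j ∈ Finset.univ.erase i, (ζ i - ζ j), ?_⟩
  refine eq_of_degrees_lt_of_eval_index_eq (v := ζ) Finset.univ hζ.injOn ?_ ?_ fun i _ => ?_
  · rw [Finset.card_univ, Fintype.card_fin]
    refine (degree_le_of_natDegree_le (natDegree_sum_le_of_forall_le (n := m) _ _ fun i _ => ?_)
      ).trans_lt (by exact_mod_cast Nat.lt_succ_self m)
    refine (natDegree_C_mul_le _ _).trans ((natDegree_prod_le _ _).trans ?_)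
    simp
  · rw [Finset.card_univ, Fintype.card_fin]
    exact (degree_le_of_natDegree_le ht).trans_lt (by exact_mod_cast Nat.lt_succ_self m)
  · rw [eval_finsetSum, Finset.sum_eq_single i]
    · simp only [eval_mul, eval_C, eval_prod, eval_sub, eval_X]
      exact div_mul_cancel₀ _ (hne i)
    · intro j _ hji
      rw [eval_mul, eval_prod, Finset.prod_eq_zero (Finset.mem_erase.mpr ⟨hji.symm,
        Finset.mem_univ i⟩) (by simp), mul_zero]
    · intro h
      exact absurd (Finset.mem_univ i) h

/-- For `A = diag(-ζ)`, `B = 1` and diagonal `S`, the restriction of `P` is the nodal polynomial of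
the `ζ i`, and that of `T` is a combination of its cofactors. With roots of unity as nodes, Lagrange
interpolation realizes the pair found above. -/
theorem exists_tripleDiscr_ne_zero (k : ℕ) :
    ∃ A B S : Matrix (Fin (k + 2)) (Fin (k + 2)) ℂ, A.IsSymm ∧ B.IsSymm ∧ S.IsSymm ∧
      tripleDiscr k A B S ≠ 0 := by
  obtain ⟨t, htd, hp1, hp2, ht, hw, hpt⟩ := exists_pairDiscr_ne_zero k
  obtain ⟨ζ, hζ, hprod⟩ := exists_nodes (k + 1)
  obtain ⟨s, hs⟩ := exists_sum_nodal_eq hζ htd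
  set A : Matrix (Fin (k + 2)) (Fin (k + 2)) ℂ := Matrix.diagonal fun i => -ζ i with hA
  set S : Matrix (Fin (k + 2)) (Fin (k + 2)) ℂ := Matrix.diagonal s with hS
  have hline : lineMatrix A 1 = Matrix.diagonal fun i => X - C (ζ i) := by
    ext i j : 2
    by_cases hij : i = j
    · subst hij
      simp [lineMatrix, hA]
      ring
    · simp [lineMatrix, hA, hij]
  have hP : restrictLine (detPoly A 1) = X ^ (k + 2) - 1 := by
    rw [restrictLine_detPoly, hline, Matrix.det_diagonal, hprod]
  have hT : restrictLine (tracePoly A 1 S) = t := by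
    rw [restrictLine_tracePoly, hline, Matrix.adjugate_diagonal, hS,
      Matrix.diagonal_map (map_zero C), Matrix.diagonal_mul_diagonal, Matrix.trace_diagonal, ← hs]
  have hPh := isHomogeneous_detPoly A 1
  have hTh := isHomogeneous_tracePoly A 1 S
  refine ⟨A, 1, S, Matrix.isSymm_diagonal _, Matrix.isSymm_one, Matrix.isSymm_diagonal _, ?_⟩
  rw [tripleDiscr, ← restrictLine_detPoly, ← restrictLine_tracePoly,
    pairDiscr_ne_zero_iff (natDegree_restrictLine_le hPh) (natDegree_restrictLine_le hTh)
      (restrictLine_jacobian hPh hTh ▸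
        natDegree_restrictLine_le (isHomogeneous_jacobian hPh hTh)), hP, hT]
  exact ⟨⟨hp1, hp2⟩, ht, hw, hpt⟩

end Witness

/-! ### Genericity -/

section Genericity

open MvPolynomial

/-- The generic matrices. -/
def genericMatrix (n l : ℕ) (i : Fin l) :
    Matrix (Fin n) (Fin n) (MvPolynomial (Fin l × Fin n × Fin n) ℂ) :=
  Matrix.of fun a b => X (i, a, b)

lemma map_genericMatrix {n l : ℕ} (M : Fin l → Matrix (Fin n) (Fin n) ℂ) (i : Fin l) :
    (genericMatrix n l i).map (eval fun t => M t.1 t.2.1 t.2.2) = M i := by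
  ext a b
  simp [genericMatrix]

lemma map_C_map_eval {n l : ℕ} (M : Fin l → Matrix (Fin n) (Fin n) ℂ)
    (A : Matrix (Fin n) (Fin n) ℂ) :
    (A.map C).map (eval fun t : Fin l × Fin n × Fin n => M t.1 t.2.1 t.2.2) = A := by
  ext a b
  simp

/-- A property that holds off the zero set of a polynomial function `φ ≠ 0` is generic. -/
lemma genericallySymm_of_forall {n l : ℕ} {p : (Fin l → Matrix (Fin n) (Fin n) ℂ) → Prop}
    {h : MvPolynomial (Fin l × Fin n × Fin n) ℂ} {φ : (Fin l → Matrix (Fin n) (Fin n) ℂ) → ℂ}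
    (hφ : ∀ M, eval (fun t => M t.1 t.2.1 t.2.2) h = φ M)
    {M₀ : Fin l → Matrix (Fin n) (Fin n) ℂ} (hM₀ : ∀ i, (M₀ i).IsSymm) (hne : φ M₀ ≠ 0)
    (hp : ∀ M, φ M ≠ 0 → p M) : GenericallySymm n l p := by
  refine ⟨{h}, ⟨M₀, hM₀, h, rfl, by rwa [hφ]⟩, ?_⟩
  rintro M _ ⟨_, rfl, hh⟩
  exact hp M (by rwa [← hφ])

/-- A property of `S` that holds whenever the discriminant of `A`, `B`, `S` does not vanish is
generic. -/
lemma genericallySymm_one {k : ℕ} {A B S : Matrix (Fin (k + 2)) (Fin (k + 2)) ℂ} (hS : S.IsSymm)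
    (h : tripleDiscr k A B S ≠ 0)
    {p : (Fin 1 → Matrix (Fin (k + 2)) (Fin (k + 2)) ℂ) → Prop}
    (hp : ∀ N, tripleDiscr k A B (N 0) ≠ 0 → p N) : GenericallySymm (k + 2) 1 p := by
  refine genericallySymm_of_forall
    (h := tripleDiscr k (A.map C) (B.map C) (genericMatrix (k + 2) 1 0))
    (φ := fun N => tripleDiscr k A B (N 0)) (fun N => ?_) (M₀ := fun _ => S) (fun _ => hS) h hp
  rw [← map_tripleDiscr, map_genericMatrix, map_C_map_eval, map_C_map_eval]

/-- A property of `A`, `B` that holds whenever the discriminant of `A`, `B`, `S` does not vanish is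
generic. -/
lemma genericallySymm_two {k : ℕ} {A B S : Matrix (Fin (k + 2)) (Fin (k + 2)) ℂ} (hA : A.IsSymm)
    (hB : B.IsSymm) (h : tripleDiscr k A B S ≠ 0)
    {p : (Fin 2 → Matrix (Fin (k + 2)) (Fin (k + 2)) ℂ) → Prop}
    (hp : ∀ M, tripleDiscr k (M 0) (M 1) S ≠ 0 → p M) : GenericallySymm (k + 2) 2 p := by
  refine genericallySymm_of_forall
    (h := tripleDiscr k (genericMatrix (k + 2) 2 0) (genericMatrix (k + 2) 2 1) (S.map C))
    (φ := fun M => tripleDiscr k (M 0) (M 1) S) (fun M => ?_) (M₀ := ![A, B]) (fun i => ?_) h hp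
  · rw [← map_tripleDiscr, map_genericMatrix, map_genericMatrix, map_C_map_eval]
  · fin_cases i
    · exact hA
    · exact hB

end Genericity

end GaussianCovariance

end

open GaussianCovariance in
theorem mainTheorem4 (n : ℕ) (hn : 2 ≤ n) :
    GenericallySymm n 2 fun M => ∃ d : ℕ, IsMLDegree (M 0) (M 1) d ∧
      GenericallySymm n 1 fun N =>
        ∀ F G : MvPolynomial (Fin 3) ℂ,
          F = homogenization (scoreF (M 0) (M 1) (N 0)) →
          G = homogenization (scoreG (M 0) (M 1) (N 0)) →
          (projVariety {F, G, MvPolynomial.X 2}).Finite ∧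
          intersectionMultiplicity originPoint F G ≠ ⊤ ∧
          (∀ q ∈ projVariety {F, G, MvPolynomial.X 2}, intersectionMultiplicity q F G ≠ ⊤) ∧
          (d : ℤ) = (2 * (n : ℤ) - 1) ^ 2
            - ((intersectionMultiplicity originPoint F G).toNat : ℤ)
            - ∑ᶠ q ∈ projVariety {F, G, MvPolynomial.X 2},
                ((intersectionMultiplicity q F G).toNat : ℤ) := by
  obtain ⟨k, rfl⟩ : ∃ k, n = k + 2 := ⟨n - 2, by omega⟩
  obtain ⟨A, B, S, hA, hB, hS, hne⟩ := exists_tripleDiscr_ne_zero k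
  -- One fixed `S` defines the open set of pairs, so for every pair in it the same `S` shows that
  -- the open set of sample matrices is non-empty.
  refine genericallySymm_two hA hB hne fun M hM => ⟨2 * k + 1, ?_, ?_⟩
  · exact genericallySymm_one hS hM fun N hN =>
      (isGenericPair_of_tripleDiscr_ne_zero hN).hasDegree
  · exact genericallySymm_one hS hM fun N hN =>
      (isGenericPair_of_tripleDiscr_ne_zero hN).intersection_formula
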